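/- Let $d\ge 1$ and $\kappa=(\kappa_1,\dots,\kappa_{d+1})$ with all $\kappa_i\ge 0$. Let $B^m$ denote the closed Euclidean unit ball of $\mathbb{R}^m$, and on $B^d$ consider the product weight $$W_\kappa^B(x)=\prod_{i=1}^d|x_i|^{2\kappa_i}\,(1-\|x\|^2)^{\kappa_{d+1}-1/2}$$ and the distance $d_B(x,y)=\arccos\bigl(\langle x,y\rangle+\sqrt{1-\|x\|^2}\sqrt{1-\|y\|^2}\bigr)$. For $f\in L^1(W_\kappa^B;B^d)$ and $x\in B^d$ let $$M_\kappa^Bf(x)=\sup_{0<\theta\le\pi}\frac{\int_{\{y\in B^d:\,d_B(x,y)\le\theta\}}|f(y)|W_\kappa^B(y)\,dy}{\int_{\{y\in B^d:\,d_B(x,y)\le\theta\}}W_\kappa^B(y)\,dy},\qquad \mathcal{M}_\kappa^Bf(x)=\sup_{0<\theta\le\pi}\frac{\int_{B^d}|f(y)|\,V_\kappa^B[\chi_{e(x,\theta)}](Y)\,W_\kappa^B(y)\,dy}{\int_{B^d}V_\kappa^B[\chi_{e(x,\theta)}](Y)\,W_\kappa^B(y)\,dy},$$ both with values in $[0,\infty]$.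 Here $Y=(y,\sqrt{1-\|y\|^2})$, $\chi_E$ is the indicator function of $E$, $$e(x,\theta)=\{(y,y_{d+1})\in B^{d+1}:\ \langle x,y\rangle+\sqrt{1-\|x\|^2}\,y_{d+1}\ge\cos\theta,\ y_{d+1}\ge 0\},$$ $V_\kappa^Bg(x,x_{d+1})=\frac12\bigl[V_\kappa g(x,x_{d+1})+V_\kappa g(x,-x_{d+1})\bigr]$, and $V_\kappa$ is the intertwining operator of $\mathbb{Z}_2^{d+1}$, $$V_\kappa g(x)=c_\kappa\int_{[-1,1]^{d+1}}g(x_1t_1,\dots,x_{d+1}t_{d+1})\prod_{i=1}^{d+1}(1+t_i)(1-t_i^2)^{\kappa_i-1}\,dt,$$ with $c_\kappa$ determined by $V_\kappa 1=1$; if $\kappa_i=0$, the normalized measure in $t_i$ is replaced by its weak limit as $\kappa_i\to0^+$, the unit mass at $t_i=1$. Then: (1) There is a constant $c$, depending only on $d$ and $\kappa$, such that for every $f\in L^1(W_\kappa^B;B^d)$ and every $x\in B^d$, $$\mathcal{M}_\kappa^Bf(x)\le c\sum_{\varepsilon\in\{1,-1\}^d}M_\kappa^Bf(x\varepsilon),\qquad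 x\varepsilon=(x_1\varepsilon_1,\dots,x_d\varepsilon_d).$$ (2) $W_\kappa^B$ is a doubling weight on $(B^d,d_B)$: there is a constant $C$, depending only on $d$ and $\kappa$, such that for all $x\in B^d$ and $\theta>0$, $$\int_{d_B(x,y)\le2\theta}W_\kappa^B(y)\,dy\le C\int_{d_B(x,y)\le\theta}W_\kappa^B(y)\,dy,$$ and these integrals are positive and finite. -/

import Mathlib

open MeasureTheory Set
open scoped ENNReal NNReal

namespace BallMax

noncomputable section

/-- The unnormalized density `(1 + t) (1 - t²) ^ (k - 1)` on `[-1, 1]`. -/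
def vDensity (k t : ℝ) : ℝ := (1 + t) * (1 - t ^ 2) ^ (k - 1)

/-- The one-dimensional probability measure of the intertwining operator of `ℤ₂`:
`c_k (1 + t) (1 - t²) ^ (k - 1) dt` on `[-1, 1]`, with `c_k` the normalization constant, if `k ≠ 0`;
for `k = 0` its weak limit as `k → 0+`, which is the unit mass at `1` (the measures
`c_k (1 - t²) ^ (k - 1) dt` tend to half the sum of the unit masses at `1` and `-1`, and the
factor `1 + t` takes the values `2` and `0` there). -/
def vMeasure (k : ℝ) : Measure ℝ :=
  if k = 0 then Measure.dirac 1
  else (volume.restrict (Icc (-1) 1)).withDensity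
    (fun t => ENNReal.ofReal ((∫ s in Icc (-1 : ℝ) 1, vDensity k s)⁻¹ * vDensity k t))

/-- The intertwining operator `V_κ` of the group `ℤ₂ⁿ`:
`V_κ g(x) = c_κ ∫ g(x₁ t₁, …, xₙ tₙ) ∏ᵢ (1 + tᵢ) (1 - tᵢ²) ^ (κᵢ - 1) dt` over `[-1, 1]ⁿ`,
normalized by `V_κ 1 = 1`. -/
def V {n : ℕ} (κ : Fin n → ℝ) (g : EuclideanSpace ℝ (Fin n) → ℝ)
    (x : EuclideanSpace ℝ (Fin n)) : ℝ :=
  ∫ t, g (WithLp.toLp 2 (fun i => x i * t i)) ∂(Measure.pi (fun i => vMeasure (κ i)))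

/-- `(x, x_{d+1}) ↦ (x, -x_{d+1})`. -/
def flipLast {d : ℕ} (z : EuclideanSpace ℝ (Fin (d + 1))) : EuclideanSpace ℝ (Fin (d + 1)) :=
  WithLp.toLp 2 (fun i => if i = Fin.last d then -z i else z i)

/-- `V_κ^B g(x, x_{d+1}) = (V_κ g(x, x_{d+1}) + V_κ g(x, -x_{d+1})) / 2`. -/
def VB {d : ℕ} (κ : Fin (d + 1) → ℝ) (g : EuclideanSpace ℝ (Fin (d + 1)) → ℝ)
    (z : EuclideanSpace ℝ (Fin (d + 1))) : ℝ :=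
  (1 / 2) * (V κ g z + V κ g (flipLast z))

/-- The lift `x ↦ X = (x, √(1 - ‖x‖²))` of the ball to the upper half sphere. -/
def lift {d : ℕ} (x : EuclideanSpace ℝ (Fin d)) : EuclideanSpace ℝ (Fin (d + 1)) :=
  WithLp.toLp 2 (Fin.snoc (α := fun _ => ℝ) (fun i => x i) (√(1 - ‖x‖ ^ 2)))

/-- The closed unit ball `B^d`. -/
abbrev B (d : ℕ) : Set (EuclideanSpace ℝ (Fin d)) := Metric.closedBall 0 1

/-- The weight `W_κ^B(x) = ∏_{i ≤ d} |xᵢ| ^ (2 κᵢ) (1 - ‖x‖²) ^ (κ_{d+1} - 1/2)` on `B^d`. -/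
def W {d : ℕ} (κ : Fin (d + 1) → ℝ) (x : EuclideanSpace ℝ (Fin d)) : ℝ :=
  (∏ i : Fin d, |x i| ^ (2 * κ i.castSucc)) * (1 - ‖x‖ ^ 2) ^ (κ (Fin.last d) - 1 / 2)

/-- The measure `W_κ^B(x) dx` on the ball `B^d`. -/
def measB {d : ℕ} (κ : Fin (d + 1) → ℝ) : Measure (EuclideanSpace ℝ (Fin d)) :=
  (volume.restrict (B d)).withDensity (fun y => ENNReal.ofReal (W κ y))

/-- The distance `d_B` on `B^d`. -/
def distB {d : ℕ} (x y : EuclideanSpace ℝ (Fin d)) : ℝ :=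
  Real.arccos (inner ℝ x y + √(1 - ‖x‖ ^ 2) * √(1 - ‖y‖ ^ 2))

/-- The closed `d_B`-ball `{y ∈ B^d : d_B(x, y) ≤ θ}`. -/
def capB {d : ℕ} (x : EuclideanSpace ℝ (Fin d)) (θ : ℝ) : Set (EuclideanSpace ℝ (Fin d)) :=
  {y | y ∈ B d ∧ distB x y ≤ θ}

/-- The set `e(x, θ)` of all `(y, y_{d+1}) ∈ B^{d+1}` with
`⟨x, y⟩ + √(1 - ‖x‖²) y_{d+1} ≥ cos θ` and `y_{d+1} ≥ 0`. -/
def e {d : ℕ} (x : EuclideanSpace ℝ (Fin d)) (θ : ℝ) : Set (EuclideanSpace ℝ (Fin (d + 1))) :=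
  {z | z ∈ B (d + 1) ∧
    Real.cos θ ≤ (∑ i : Fin d, x i * z i.castSucc) + √(1 - ‖x‖ ^ 2) * z (Fin.last d) ∧
    0 ≤ z (Fin.last d)}

/-- The kernel `y ↦ V_κ^B[χ_{e(x, θ)}](Y)`, where `Y = (y, √(1 - ‖y‖²))`. -/
def kernelB {d : ℕ} (κ : Fin (d + 1) → ℝ) (x : EuclideanSpace ℝ (Fin d)) (θ : ℝ)
    (y : EuclideanSpace ℝ (Fin d)) : ℝ :=
  VB κ ((e x θ).indicator (fun _ => 1)) (lift y)

/-- The maximal function `𝓜_κ^B f`, with values in `[0, ∞]`. -/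
def calM {d : ℕ} (κ : Fin (d + 1) → ℝ) (f : EuclideanSpace ℝ (Fin d) → ℝ)
    (x : EuclideanSpace ℝ (Fin d)) : ℝ≥0∞ :=
  ⨆ θ ∈ Ioc (0 : ℝ) Real.pi,
    (∫⁻ y, ENNReal.ofReal |f y| * ENNReal.ofReal (kernelB κ x θ y) ∂(measB κ)) /
      (∫⁻ y, ENNReal.ofReal (kernelB κ x θ y) ∂(measB κ))

/-- The weighted Hardy–Littlewood maximal function `M_κ^B f` for the distance `d_B`, with values
in `[0, ∞]`. -/
def hlM {d : ℕ} (κ : Fin (d + 1) → ℝ) (f : EuclideanSpace ℝ (Fin d) → ℝ)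
    (x : EuclideanSpace ℝ (Fin d)) : ℝ≥0∞ :=
  ⨆ θ ∈ Ioc (0 : ℝ) Real.pi,
    (∫⁻ y in capB x θ, ENNReal.ofReal |f y| ∂(measB κ)) / measB κ (capB x θ)

/-- The action `x ε = (x₁ ε₁, …, x_d ε_d)` of `ε ∈ ℤ₂^d = {1, -1}^d`. -/
def signAct {d : ℕ} (x : EuclideanSpace ℝ (Fin d)) (ε : Fin d → ℤˣ) :
    EuclideanSpace ℝ (Fin d) :=
  WithLp.toLp 2 (fun i => x i * ((ε i : ℤ) : ℝ))

end

end BallMax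

/-! Write X = `lift x` and let r = `capRatio x θ`, so r_i = (θ / (|X_i| + θ))². Everything follows
from two size estimates.

Caps: `measB κ (capB x θ)` is comparable to θ^d ∏ (|X_i| + θ)^(2κ_i) (`measB_capB_le`,
`le_measB_capB`). The weight W is the homogeneous product weight on the half space, restricted to
the half sphere and written in the coordinates of the ball, so polar coordinates reduce the measure
of a cap to the weighted measure of a cube near X, which factorizes. Doubling is immediate. Since
only the |X_i| enter, caps of equal radius about x and xε have comparable measure.

Kernel: V_κ^B[χ_e] is half the sum of two probabilities, over random t, that the dilate by t of Y or
of its reflection lies in e(x, θ). Such t force y into some `capB (signAct x ε) θ` and 1 - |t_i| ≤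
18 r_i for all i (`one_sub_abs_le_of_mem_dilationSet`). Conversely, for y in `capB x (θ / 4)` all t
with 0 ≤ 1 - t_i ≤ c r_i qualify (`mem_dilationSet_of_forall_le`). The one-dimensional measures give
windows of width δ at the endpoints mass of order δ^κ_i, so the kernel is at most a multiple of ∏
r_i^κ_i on the union of the caps, zero elsewhere, and at least a multiple of it on `capB x (θ / 4)`.

In the quotient defining `calM` the factor ∏ r_i^κ_i cancels, and the caps about the points xε are
compared with `capB x (θ / 4)`. -/

namespace BallMax

/-! ### Polar coordinates and the product weight on the half space -/

/-- Scaling of the Lebesgue integral. -/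
theorem lintegral_eq_lintegral_smul {d : ℕ} {G : EuclideanSpace ℝ (Fin d) → ℝ≥0∞}
    (hG : Measurable G) {r : ℝ} (hr : 0 < r) :
    ∫⁻ w, G w = ENNReal.ofReal (r ^ d) * ∫⁻ y, G (r • y) := by
  have h1 : ∫⁻ y, G (r • y) = ENNReal.ofReal (r ^ d)⁻¹ * ∫⁻ w, G w := by
    rw [← lintegral_map hG (measurable_const_smul r), Measure.map_addHaar_smul _ hr.ne',
      lintegral_smul_measure, finrank_euclideanSpace_fin, abs_of_pos (by positivity), smul_eq_mul]
  rw [h1, ← mul_assoc, ← ENNReal.ofReal_mul (by positivity), mul_inv_cancel₀ (by positivity),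
    ENNReal.ofReal_one, one_mul]

/-- The substitution `z = √(r² - a²)`. -/
theorem lintegral_Ioi_eq_lintegral_sqrt {a : ℝ} (ha : 0 ≤ a) (g : ℝ → ℝ≥0∞) :
    ∫⁻ z in Ioi (0 : ℝ), g z =
      ∫⁻ r in Ioi a, ENNReal.ofReal (r / √(r ^ 2 - a ^ 2)) * g (√(r ^ 2 - a ^ 2)) := by
  have hpos : ∀ r ∈ Ioi a, 0 < r ^ 2 - a ^ 2 := fun r hr => by
    have : a < r := hr
    nlinarith
  have himg : (fun r : ℝ => √(r ^ 2 - a ^ 2)) '' Ioi a = Ioi 0 := by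
    ext z
    constructor
    · rintro ⟨r, hr, rfl⟩
      exact Real.sqrt_pos.2 (hpos r hr)
    · intro hz
      have hz : 0 < z := hz
      refine ⟨√(z ^ 2 + a ^ 2), ?_, ?_⟩
      · exact Real.lt_sqrt_of_sq_lt (by nlinarith)
      · simp only
        rw [Real.sq_sqrt (by positivity), add_sub_cancel_right, Real.sqrt_sq hz.le]
  have hinj : InjOn (fun r : ℝ => √(r ^ 2 - a ^ 2)) (Ioi a) := by
    intro r hr s hs h
    have h2 := (Real.sqrt_inj (hpos r hr).le (hpos s hs).le).1 h
    have hr : a < r := hr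
    have hs : a < s := hs
    nlinarith [sq_nonneg (r - s)]
  have hder : ∀ r ∈ Ioi a, HasDerivWithinAt (fun r : ℝ => √(r ^ 2 - a ^ 2))
      (r / √(r ^ 2 - a ^ 2)) (Ioi a) r := by
    intro r hr
    have h1 : HasDerivAt (fun r : ℝ => r ^ 2 - a ^ 2) (2 * r) r := by
      simpa using (hasDerivAt_pow 2 r).sub_const (a ^ 2)
    have h2 := h1.sqrt (hpos r hr).ne'
    rw [mul_div_mul_left _ _ two_ne_zero] at h2
    exact h2.hasDerivWithinAt
  rw [← himg, lintegral_image_eq_lintegral_abs_deriv_mul measurableSet_Ioi hder hinj]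
  refine setLIntegral_congr_fun measurableSet_Ioi fun r hr => ?_
  have hr0 : 0 ≤ r := ha.trans (le_of_lt hr)
  rw [abs_of_nonneg (by positivity)]

/-- Polar coordinates on the half space `{(w, z) : 0 < z}`, the upper half sphere being
parametrized by the ball. -/
theorem lintegral_halfSpace_eq_polar {d : ℕ} {F : EuclideanSpace ℝ (Fin d) → ℝ → ℝ≥0∞}
    (hF : Measurable (Function.uncurry F)) :
    ∫⁻ w, ∫⁻ z in Ioi (0 : ℝ), F w z =
      ∫⁻ r in Ioi (0 : ℝ), ENNReal.ofReal (r ^ d) *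
        ∫⁻ y in Metric.ball 0 1, ENNReal.ofReal (1 / √(1 - ‖y‖ ^ 2)) *
          F (r • y) (r * √(1 - ‖y‖ ^ 2)) := by
  have hS : MeasurableSet {p : EuclideanSpace ℝ (Fin d) × ℝ | ‖p.1‖ < p.2} :=
    measurableSet_lt (by fun_prop) (by fun_prop)
  -- For fixed w, the variable z is replaced by the radius r = √(‖w‖² + z²) > ‖w‖. After Tonelli,
  -- the scaling w = r • y turns the range ‖w‖ < r into the unit ball.
  set H : EuclideanSpace ℝ (Fin d) → ℝ → ℝ≥0∞ := fun w r =>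
    ENNReal.ofReal (r / √(r ^ 2 - ‖w‖ ^ 2)) * F w (√(r ^ 2 - ‖w‖ ^ 2)) with hH
  have hHm : Measurable (Function.uncurry H) := by
    refine Measurable.mul (by fun_prop) ?_
    have hg : Measurable fun p : EuclideanSpace ℝ (Fin d) × ℝ => (p.1, √(p.2 ^ 2 - ‖p.1‖ ^ 2)) := by
      fun_prop
    exact hF.comp hg
  have hKm : Measurable (fun p : EuclideanSpace ℝ (Fin d) × ℝ =>
      {p : EuclideanSpace ℝ (Fin d) × ℝ | ‖p.1‖ < p.2}.indicator (Function.uncurry H) p) :=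
    hHm.indicator hS
  have hKr : ∀ r : ℝ, Measurable (fun w => {p : EuclideanSpace ℝ (Fin d) × ℝ |
      ‖p.1‖ < p.2}.indicator (Function.uncurry H) (w, r)) :=
    fun r => hKm.comp measurable_prodMk_right
  have h1 : ∀ w, ∫⁻ z in Ioi (0 : ℝ), F w z = ∫⁻ r, {p : EuclideanSpace ℝ (Fin d) × ℝ |
      ‖p.1‖ < p.2}.indicator (Function.uncurry H) (w, r) := by
    intro w
    rw [lintegral_Ioi_eq_lintegral_sqrt (norm_nonneg w), ← lintegral_indicator measurableSet_Ioi]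
    rfl
  simp_rw [h1]
  rw [lintegral_lintegral_swap hKm.aemeasurable, ← lintegral_indicator measurableSet_Ioi]
  refine lintegral_congr fun r => ?_
  rcases le_or_gt r 0 with hr | hr
  · rw [indicator_of_notMem (by simpa using hr)]
    rw [lintegral_eq_zero_iff (hKr r)]
    refine .of_forall fun w => ?_
    exact indicator_of_notMem (fun h : ‖w‖ < r => absurd (h.trans_le hr) (norm_nonneg w).not_gt) _
  · rw [indicator_of_mem (by simpa using hr),
      lintegral_eq_lintegral_smul (hKr r) hr,
      ← lintegral_indicator measurableSet_ball]
    have hnorm : ∀ y : EuclideanSpace ℝ (Fin d), (r • y, r) ∈ {p : EuclideanSpace ℝ (Fin d) × ℝ |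
        ‖p.1‖ < p.2} ↔ y ∈ Metric.ball 0 1 := fun y => by
      rw [mem_ofPred_eq, mem_ball_zero_iff, norm_smul, Real.norm_of_nonneg hr.le,
        mul_lt_iff_lt_one_right hr]
    congr 1
    refine lintegral_congr fun y => ?_
    by_cases hy : ‖y‖ < 1
    · have h2 : √(r ^ 2 - ‖r • y‖ ^ 2) = r * √(1 - ‖y‖ ^ 2) := by
        rw [norm_smul, Real.norm_of_nonneg hr.le, mul_pow, ← mul_one_sub,
          Real.sqrt_mul (by positivity), Real.sqrt_sq hr.le]
      rw [indicator_of_mem ((hnorm y).2 (by simpa using hy)), indicator_of_mem]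
      · simp only [Function.uncurry, hH, h2]
        rw [← div_div, div_self hr.ne']
      · simpa using hy
    · rw [indicator_of_notMem (fun h => hy (by simpa using (hnorm y).1 h)), indicator_of_notMem]
      simpa using hy

/-- The weight `∏ |wᵢ| ^ (2 κᵢ) |z| ^ (2 κ_{d+1})` on `ℝ^d × ℝ`. -/
noncomputable def coneWeight {d : ℕ} (κ : Fin (d + 1) → ℝ) (w : EuclideanSpace ℝ (Fin d)) (z : ℝ) :
    ℝ :=
  (∏ i : Fin d, |w i| ^ (2 * κ i.castSucc)) * |z| ^ (2 * κ (Fin.last d))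

@[fun_prop]
theorem measurable_coneWeight {d : ℕ} (κ : Fin (d + 1) → ℝ) :
    Measurable (fun p : EuclideanSpace ℝ (Fin d) × ℝ => coneWeight κ p.1 p.2) := by
  unfold coneWeight
  fun_prop

/-- The homogeneous dimension `d + 2 ∑ κᵢ`. -/
noncomputable def homDim {d : ℕ} (κ : Fin (d + 1) → ℝ) : ℝ := d + 2 * ∑ i, κ i

/-- Homogeneity of degree 2 ∑ κ_i, together with the Jacobian r^d, gives the power of r. The factor
1/√(1 - ‖y‖²) of surface measure is what lowers the last exponent from κ_{d+1} to κ_{d+1} - 1/2. -/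
theorem coneWeight_smul {d : ℕ} (κ : Fin (d + 1) → ℝ) {r : ℝ} (hr : 0 < r)
    {y : EuclideanSpace ℝ (Fin d)} (hy : ‖y‖ < 1) :
    r ^ d * (1 / √(1 - ‖y‖ ^ 2) * coneWeight κ (r • y) (r * √(1 - ‖y‖ ^ 2))) =
      r ^ homDim κ * W κ y := by
  have hu : 0 < 1 - ‖y‖ ^ 2 := by nlinarith [norm_nonneg y]
  set u := 1 - ‖y‖ ^ 2 with hu'
  have h1 : ∏ i : Fin d, |(r • y) i| ^ (2 * κ i.castSucc) =
      (∏ i : Fin d, r ^ (2 * κ i.castSucc)) * ∏ i : Fin d, |y i| ^ (2 * κ i.castSucc) := by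
    rw [← Finset.prod_mul_distrib]
    refine Finset.prod_congr rfl fun i _ => ?_
    rw [PiLp.smul_apply, smul_eq_mul, abs_mul, abs_of_pos hr,
      Real.mul_rpow hr.le (abs_nonneg _)]
  have h2 : |r * √u| ^ (2 * κ (Fin.last d)) = r ^ (2 * κ (Fin.last d)) * u ^ κ (Fin.last d) := by
    rw [abs_of_nonneg (by positivity), Real.mul_rpow hr.le (by positivity), Real.rpow_mul
      (Real.sqrt_nonneg u), Real.rpow_two, Real.sq_sqrt hu.le]
  have h3 : r ^ homDim κ =
      r ^ d * ((∏ i : Fin d, r ^ (2 * κ i.castSucc)) * r ^ (2 * κ (Fin.last d))) := by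
    rw [homDim, Real.rpow_add hr, Real.rpow_natCast, Finset.mul_sum, Fin.sum_univ_castSucc,
      Real.rpow_add hr, Real.rpow_sum_of_pos hr]
  have h4 : u ^ (κ (Fin.last d) - 1 / 2) = u ^ κ (Fin.last d) * (1 / √u) := by
    rw [Real.rpow_sub hu, Real.sqrt_eq_rpow]
    ring
  rw [coneWeight, h1, h2, h3, W, h4]
  ring

/-- The polar formula lives on the open ball, where √(1 - ‖y‖²) > 0; the boundary sphere is Lebesgue
null. -/
theorem measB_apply {d : ℕ} (κ : Fin (d + 1) → ℝ) {S : Set (EuclideanSpace ℝ (Fin d))}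
    (hd : 1 ≤ d) (hS : MeasurableSet S) :
    measB κ S = ∫⁻ y in Metric.ball 0 1, S.indicator (fun y => ENNReal.ofReal (W κ y)) y := by
  have : Nonempty (Fin d) := ⟨⟨0, hd⟩⟩
  have hb : (volume.restrict (B d) : Measure (EuclideanSpace ℝ (Fin d))) =
      volume.restrict (Metric.ball 0 1) := by
    refine Measure.restrict_congr_set ?_
    rw [B, ← Metric.ball_union_sphere]
    exact union_ae_eq_left_of_ae_eq_empty (ae_eq_empty.2 (Measure.addHaar_sphere _ _ _))
  rw [measB, withDensity_apply _ hS, hb, lintegral_indicator hS]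

/-- The weighted measure of a subset of the half space in polar coordinates. -/
theorem lintegral_coneWeight {d : ℕ} (κ : Fin (d + 1) → ℝ) (hd : 1 ≤ d)
    {A : Set (EuclideanSpace ℝ (Fin d) × ℝ)} (hA : MeasurableSet A) :
    ∫⁻ w, ∫⁻ z in Ioi (0 : ℝ),
        A.indicator (fun p => ENNReal.ofReal (coneWeight κ p.1 p.2)) (w, z) =
      ∫⁻ r in Ioi (0 : ℝ), ENNReal.ofReal (r ^ homDim κ) *
        measB κ {y | (r • y, r * √(1 - ‖y‖ ^ 2)) ∈ A} := by
  rw [lintegral_halfSpace_eq_polar (F := fun w z =>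
    A.indicator (fun p => ENNReal.ofReal (coneWeight κ p.1 p.2)) (w, z))
    (Measurable.indicator (by fun_prop) hA)]
  refine setLIntegral_congr_fun measurableSet_Ioi fun r hr => ?_
  have hr : 0 < r := hr
  have hS : MeasurableSet {y : EuclideanSpace ℝ (Fin d) | (r • y, r * √(1 - ‖y‖ ^ 2)) ∈ A} :=
    hA.preimage (f := fun y => (r • y, r * √(1 - ‖y‖ ^ 2))) (by fun_prop)
  rw [measB_apply κ hd hS, ← lintegral_const_mul' _ _ ENNReal.ofReal_ne_top,
    ← lintegral_const_mul' _ _ ENNReal.ofReal_ne_top]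
  refine setLIntegral_congr_fun measurableSet_ball fun y hy => ?_
  by_cases hyA : (r • y, r * √(1 - ‖y‖ ^ 2)) ∈ A
  · simp only [indicator_of_mem hyA]
    rw [indicator_of_mem (by exact hyA), ← ENNReal.ofReal_mul (by positivity),
      ← ENNReal.ofReal_mul (by positivity), ← ENNReal.ofReal_mul (by positivity),
      coneWeight_smul κ hr (by simpa using hy)]
  · simp only [indicator_of_notMem hyA]
    rw [indicator_of_notMem (by exact hyA), mul_zero, mul_zero, mul_zero]

/-! ### Weighted measure of cubes -/

/-- A cube in `ℝ^d × ℝ` with lower corner `l` and edge `s`. -/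
def cube {d : ℕ} (l : Fin (d + 1) → ℝ) (s : ℝ) : Set (EuclideanSpace ℝ (Fin d) × ℝ) :=
  {w : EuclideanSpace ℝ (Fin d) | ∀ i : Fin d, w i ∈ Ioo (l i.castSucc) (l i.castSucc + s)} ×ˢ
    Ioo (l (Fin.last d)) (l (Fin.last d) + s)

theorem cube_fst_eq_preimage {d : ℕ} (l : Fin (d + 1) → ℝ) (s : ℝ) :
    {w : EuclideanSpace ℝ (Fin d) | ∀ i : Fin d, w i ∈ Ioo (l i.castSucc) (l i.castSucc + s)} =
      (WithLp.ofLp ⁻¹' univ.pi fun i : Fin d => Ioo (l i.castSucc) (l i.castSucc + s)) := by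
  ext w
  simp

theorem measurableSet_cube {d : ℕ} (l : Fin (d + 1) → ℝ) (s : ℝ) : MeasurableSet (cube l s) := by
  refine MeasurableSet.prod ?_ measurableSet_Ioo
  rw [cube_fst_eq_preimage]
  exact (MeasurableSet.univ_pi fun i => measurableSet_Ioo).preimage
    (PiLp.volume_preserving_ofLp (Fin d)).measurable

theorem volume_cube {d : ℕ} (l : Fin (d + 1) → ℝ) {s : ℝ} (hs : 0 ≤ s) :
    (volume.prod volume) (cube l s) = ENNReal.ofReal (s ^ (d + 1)) := by
  rw [cube, Measure.prod_prod, cube_fst_eq_preimage,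
    (PiLp.volume_preserving_ofLp (Fin d)).measure_preimage
      (MeasurableSet.univ_pi fun i => measurableSet_Ioo).nullMeasurableSet, volume_pi_pi]
  simp [Real.volume_Ioo, ENNReal.ofReal_pow hs, -ENNReal.ofReal_pow, pow_succ, ENNReal.ofReal_mul (pow_nonneg hs d)]

theorem lintegral_cube_const {d : ℕ} (l : Fin (d + 1) → ℝ) {s : ℝ} (hs : 0 ≤ s) {m : ℝ}
    (hm : 0 ≤ m) :
    ∫⁻ w, ∫⁻ z, (cube l s).indicator (fun _ => ENNReal.ofReal m) (w, z) =
      ENNReal.ofReal (m * s ^ (d + 1)) := by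
  rw [← lintegral_prod (μ := volume) (ν := volume)
      (fun p => (cube l s).indicator (fun _ => ENNReal.ofReal m) p)
      (measurable_const.indicator (measurableSet_cube l s)).aemeasurable,
    lintegral_indicator_const (measurableSet_cube l s), volume_cube l hs, ENNReal.ofReal_mul hm]

theorem lintegral_coneWeight_cube_le {d : ℕ} (κ : Fin (d + 1) → ℝ) (l : Fin (d + 1) → ℝ) {s : ℝ}
    (hs : 0 ≤ s) {m : Fin (d + 1) → ℝ} (hm : ∀ i, 0 ≤ m i)
    (h : ∀ i, ∀ t ∈ Ioo (l i) (l i + s), |t| ^ (2 * κ i) ≤ m i) :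
    ∫⁻ w, ∫⁻ z in Ioi (0 : ℝ),
        (cube l s).indicator (fun p => ENNReal.ofReal (coneWeight κ p.1 p.2)) (w, z) ≤
      ENNReal.ofReal ((∏ i, m i) * s ^ (d + 1)) := by
  rw [← lintegral_cube_const l hs (Finset.prod_nonneg fun i _ => hm i)]
  refine lintegral_mono fun w => (setLIntegral_le_lintegral _ _).trans (lintegral_mono fun z => ?_)
  by_cases hp : (w, z) ∈ cube l s
  · rw [indicator_of_mem hp, indicator_of_mem hp]
    refine ENNReal.ofReal_le_ofReal ?_
    rw [coneWeight, Fin.prod_univ_castSucc]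
    exact mul_le_mul (Finset.prod_le_prod (fun i _ => by positivity) fun i _ => h _ _ (hp.1 i))
      (h _ _ hp.2) (by positivity) (Finset.prod_nonneg fun i _ => hm _)
  · rw [indicator_of_notMem hp, indicator_of_notMem hp]

/-- The condition `hl` keeps the cube inside the half space, so the restriction to z > 0 loses
nothing. -/
theorem le_lintegral_coneWeight_cube {d : ℕ} (κ : Fin (d + 1) → ℝ) (l : Fin (d + 1) → ℝ) {s : ℝ}
    (hs : 0 ≤ s) {m : Fin (d + 1) → ℝ} (hm : ∀ i, 0 ≤ m i)
    (h : ∀ i, ∀ t ∈ Ioo (l i) (l i + s), m i ≤ |t| ^ (2 * κ i)) (hl : 0 ≤ l (Fin.last d)) :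
    ENNReal.ofReal ((∏ i, m i) * s ^ (d + 1)) ≤ ∫⁻ w, ∫⁻ z in Ioi (0 : ℝ),
        (cube l s).indicator (fun p => ENNReal.ofReal (coneWeight κ p.1 p.2)) (w, z) := by
  rw [← lintegral_cube_const l hs (Finset.prod_nonneg fun i _ => hm i)]
  refine lintegral_mono fun w => ?_
  rw [← lintegral_indicator measurableSet_Ioi]
  refine lintegral_mono fun z => ?_
  by_cases hp : (w, z) ∈ cube l s
  · rw [indicator_of_mem hp, indicator_of_mem (show z ∈ Ioi 0 from hl.trans_lt hp.2.1),
      indicator_of_mem hp]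
    refine ENNReal.ofReal_le_ofReal ?_
    rw [coneWeight, Fin.prod_univ_castSucc]
    exact mul_le_mul (Finset.prod_le_prod (fun i _ => hm _) fun i _ => h _ _ (hp.1 i))
      (h _ _ hp.2) (hm _) (by positivity)
  · rw [indicator_of_notMem hp]
    exact zero_le

/-! ### The lift to the half sphere; chords and arcs -/

@[simp]
theorem lift_castSucc {d : ℕ} (x : EuclideanSpace ℝ (Fin d)) (i : Fin d) :
    lift x i.castSucc = x i := by
  simp [lift]

@[simp]
theorem lift_last {d : ℕ} (x : EuclideanSpace ℝ (Fin d)) :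
    lift x (Fin.last d) = √(1 - ‖x‖ ^ 2) := by
  simp [lift]

theorem inner_lift {d : ℕ} (x y : EuclideanSpace ℝ (Fin d)) :
    inner ℝ (lift x) (lift y) = inner ℝ x y + √(1 - ‖x‖ ^ 2) * √(1 - ‖y‖ ^ 2) := by
  simp only [PiLp.inner_apply, Fin.sum_univ_castSucc, lift_castSucc, lift_last]
  simp [mul_comm]

theorem one_sub_norm_sq_nonneg {d : ℕ} {x : EuclideanSpace ℝ (Fin d)} (hx : x ∈ B d) :
    0 ≤ 1 - ‖x‖ ^ 2 := by
  have : ‖x‖ ≤ 1 := by simpa using hx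
  nlinarith [norm_nonneg x]

theorem norm_lift {d : ℕ} {x : EuclideanSpace ℝ (Fin d)} (hx : x ∈ B d) : ‖lift x‖ = 1 := by
  have h : ‖lift x‖ ^ 2 = 1 := by
    rw [← real_inner_self_eq_norm_sq, inner_lift, real_inner_self_eq_norm_sq,
      Real.mul_self_sqrt (one_sub_norm_sq_nonneg hx)]
    ring
  exact (sq_eq_sq₀ (norm_nonneg _) zero_le_one).1 (by rw [h, one_pow])

theorem inner_lift_mem_Icc {d : ℕ} {x y : EuclideanSpace ℝ (Fin d)} (hx : x ∈ B d) (hy : y ∈ B d) :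
    inner ℝ (lift x) (lift y) ∈ Icc (-1 : ℝ) 1 := by
  have h := abs_real_inner_le_norm (lift x) (lift y)
  rw [norm_lift hx, norm_lift hy, one_mul] at h
  exact abs_le.1 h

theorem norm_lift_sub_lift_sq {d : ℕ} {x y : EuclideanSpace ℝ (Fin d)} (hx : x ∈ B d)
    (hy : y ∈ B d) : ‖lift x - lift y‖ ^ 2 = 2 - 2 * inner ℝ (lift x) (lift y) := by
  rw [norm_sub_sq_real, norm_lift hx, norm_lift hy]
  ring

theorem mem_capB_iff {d : ℕ} {x y : EuclideanSpace ℝ (Fin d)} (hx : x ∈ B d) (hy : y ∈ B d) {θ : ℝ}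
    (h0 : 0 ≤ θ) (hπ : θ ≤ Real.pi) :
    y ∈ capB x θ ↔ Real.cos θ ≤ inner ℝ (lift x) (lift y) := by
  have hm := inner_lift_mem_Icc hx hy
  have h : y ∈ capB x θ ↔ Real.arccos (inner ℝ (lift x) (lift y)) ≤ θ := by
    rw [inner_lift]
    exact ⟨fun h => h.2, fun h => ⟨hy, h⟩⟩
  rw [h, ← Real.strictAntiOn_cos.le_iff_ge ⟨h0, hπ⟩
    ⟨Real.arccos_nonneg _, Real.arccos_le_pi _⟩, Real.cos_arccos hm.1 hm.2]

/-- A chord is no longer than its arc, in the form 1 - φ²/2 ≤ cos φ. -/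
theorem norm_lift_sub_lift_le {d : ℕ} {x y : EuclideanSpace ℝ (Fin d)} (hx : x ∈ B d)
    (hy : y ∈ B d) : ‖lift x - lift y‖ ≤ distB x y := by
  have hm := inner_lift_mem_Icc hx hy
  refine (sq_le_sq₀ (norm_nonneg _) (show 0 ≤ distB x y from Real.arccos_nonneg _)).1 ?_
  have hc : Real.cos (distB x y) = inner ℝ (lift x) (lift y) := by
    rw [← Real.cos_arccos hm.1 hm.2, inner_lift, distB]
  rw [norm_lift_sub_lift_sq hx hy, ← hc]
  have := Real.one_sub_sq_div_two_le_cos (x := distB x y)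
  linarith

theorem mem_capB_of_norm_le {d : ℕ} {x y : EuclideanSpace ℝ (Fin d)} (hx : x ∈ B d) (hy : y ∈ B d)
    {θ : ℝ} (h0 : 0 ≤ θ) (hπ : θ ≤ Real.pi) (h : ‖lift x - lift y‖ ≤ θ / 2) : y ∈ capB x θ := by
  rw [mem_capB_iff hx hy h0 hπ]
  have h1 := norm_lift_sub_lift_sq hx hy
  have h2 : ‖lift x - lift y‖ ^ 2 ≤ (θ / 2) ^ 2 := by gcongr
  have h3 := Real.cos_le_one_sub_mul_cos_sq (x := θ) (by rwa [abs_of_nonneg h0])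
  -- As π < 4, the bound cos θ ≤ 1 - 2θ²/π² gives cos θ ≤ 1 - θ²/8, which is the inner product
  -- belonging to a chord of length θ/2.
  have h4 : 1 / 8 ≤ 2 / Real.pi ^ 2 := by
    rw [div_le_div_iff₀ (by norm_num) (by positivity)]
    nlinarith [Real.pi_pos, Real.pi_lt_four]
  nlinarith [sq_nonneg θ, mul_le_mul_of_nonneg_right h4 (sq_nonneg θ)]

theorem measurableSet_capB {d : ℕ} (x : EuclideanSpace ℝ (Fin d)) (θ : ℝ) :
    MeasurableSet (capB x θ) := by
  have h : Continuous (distB x) := by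
    unfold distB
    fun_prop
  exact (Metric.isClosed_closedBall.inter (isClosed_le h continuous_const)).measurableSet

/-! ### Two-sided estimate for the measure of a cap -/

/-- The size `θ ^ d ∏ (|Xᵢ| + θ) ^ (2 κᵢ)` of the cap of radius `θ` about `x`. -/
noncomputable def capSize {d : ℕ} (κ : Fin (d + 1) → ℝ) (x : EuclideanSpace ℝ (Fin d)) (θ : ℝ) : ℝ :=
  θ ^ d * ∏ i, (|lift x i| + θ) ^ (2 * κ i)

theorem capSize_pos {d : ℕ} (κ : Fin (d + 1) → ℝ) (x : EuclideanSpace ℝ (Fin d)) {θ : ℝ}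
    (hθ : 0 < θ) : 0 < capSize κ x θ := by
  unfold capSize
  have : ∀ i, 0 < |lift x i| + θ := fun i => by positivity
  exact mul_pos (by positivity) (Finset.prod_pos fun i _ => Real.rpow_pos_of_pos (this i) _)

/-- This is the source of doubling: enlarging the radius by L ≥ 1 costs a factor depending on L and
κ only. -/
theorem prod_abs_add_mul_le {n : ℕ} {κ : Fin n → ℝ} (hκ : ∀ i, 0 ≤ κ i) (X : Fin n → ℝ)
    {L θ : ℝ} (hL : 1 ≤ L) (hθ : 0 ≤ θ) :
    ∏ i, (|X i| + L * θ) ^ (2 * κ i) ≤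
      (∏ i, L ^ (2 * κ i)) * ∏ i, (|X i| + θ) ^ (2 * κ i) := by
  rw [← Finset.prod_mul_distrib]
  refine Finset.prod_le_prod (fun i _ => by positivity) fun i _ => ?_
  rw [← Real.mul_rpow (by positivity) (by positivity)]
  have := hκ i
  have h : |X i| ≤ L * |X i| := le_mul_of_one_le_left (abs_nonneg _) hL
  exact Real.rpow_le_rpow (by positivity) (by linarith) (by positivity)

theorem capSize_mul_le {d : ℕ} {κ : Fin (d + 1) → ℝ} (hκ : ∀ i, 0 ≤ κ i)
    (x : EuclideanSpace ℝ (Fin d)) {L θ : ℝ} (hL : 1 ≤ L) (hθ : 0 ≤ θ) :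
    capSize κ x (L * θ) ≤ (L ^ d * ∏ i, L ^ (2 * κ i)) * capSize κ x θ := by
  unfold capSize
  rw [mul_pow, mul_mul_mul_comm]
  gcongr
  exact prod_abs_add_mul_le hκ _ hL hθ

theorem mem_cube_smul_iff {d : ℕ} {l : Fin (d + 1) → ℝ} {s r : ℝ} {y : EuclideanSpace ℝ (Fin d)} :
    (r • y, r * √(1 - ‖y‖ ^ 2)) ∈ cube l s ↔ ∀ i, (r • lift y) i ∈ Ioo (l i) (l i + s) := by
  rw [Fin.forall_fin_succ']
  simp [cube]

/-- The thickened cap {rY : 1 < r ≤ 1 + θ} lies within 2θ of X, hence in the cube of edge 6θ centred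
at X, where the weight is at most ∏ (|X_i| + 3θ)^(2κ_i). The cube has dimension d + 1; its extra
factor θ is the radial thickness and cancels. -/
theorem measB_capB_le {d : ℕ} (hd : 1 ≤ d) {κ : Fin (d + 1) → ℝ} (hκ : ∀ i, 0 ≤ κ i) :
    ∃ A : ℝ≥0, ∀ x ∈ B d, ∀ θ : ℝ, 0 < θ →
      measB κ (capB x θ) ≤ A * ENNReal.ofReal (capSize κ x θ) := by
  have hA0 : 0 ≤ (6 : ℝ) ^ (d + 1) * ∏ i, (3 : ℝ) ^ (2 * κ i) := by positivity
  refine ⟨⟨_, hA0⟩, fun x hx θ hθ => ?_⟩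
  set l : Fin (d + 1) → ℝ := fun i => lift x i - 3 * θ with hl
  have hup := lintegral_coneWeight_cube_le κ l (s := 6 * θ) (by positivity)
    (m := fun i => (|lift x i| + 3 * θ) ^ (2 * κ i)) (fun i => by positivity) (fun i t ht => by
      have := hκ i
      refine Real.rpow_le_rpow (abs_nonneg _) ?_ (by positivity)
      have h1 : |t - lift x i| ≤ 3 * θ := by
        rw [abs_le]
        constructor <;> linarith [ht.1, ht.2, congrFun hl i]
      have h2 := abs_add_le (lift x i) (t - lift x i)
      rw [add_sub_cancel] at h2
      linarith)
  rw [lintegral_coneWeight κ hd (measurableSet_cube l _)] at hup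
  have hlow : ENNReal.ofReal θ * measB κ (capB x θ) ≤ ∫⁻ r in Ioi (0 : ℝ),
      ENNReal.ofReal (r ^ homDim κ) *
        measB κ {y | (r • y, r * √(1 - ‖y‖ ^ 2)) ∈ cube l (6 * θ)} := by
    calc ENNReal.ofReal θ * measB κ (capB x θ)
        = ∫⁻ r in Ioc 1 (1 + θ), measB κ (capB x θ) := by
          rw [setLIntegral_const, Real.volume_Ioc, add_sub_cancel_left, mul_comm]
      _ ≤ ∫⁻ r in Ioc 1 (1 + θ), ENNReal.ofReal (r ^ homDim κ) *
            measB κ {y | (r • y, r * √(1 - ‖y‖ ^ 2)) ∈ cube l (6 * θ)} := by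
          refine setLIntegral_mono' measurableSet_Ioc fun r hr => ?_
          have hD : 0 ≤ homDim κ := by
            have := Finset.sum_nonneg fun i (_ : i ∈ Finset.univ) => hκ i
            unfold homDim
            positivity
          have h1 : 1 ≤ ENNReal.ofReal (r ^ homDim κ) := by
            rw [ENNReal.one_le_ofReal]
            exact Real.one_le_rpow hr.1.le hD
          refine (measure_mono fun y hy => ?_).trans (le_mul_of_one_le_left' h1)
          refine mem_cube_smul_iff.2 fun i => ?_
          have h2 : ‖r • lift y - lift x‖ ≤ 2 * θ := by
            have e : r • lift y - lift x = (r - 1) • lift y + (lift y - lift x) := by module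
            have h3 : ‖(r - 1) • lift y‖ = r - 1 := by
              rw [norm_smul, norm_lift hy.1, mul_one, Real.norm_of_nonneg (by linarith [hr.1])]
            have h4 := norm_lift_sub_lift_le hx hy.1
            rw [norm_sub_rev] at h4
            rw [e]
            refine (norm_add_le _ _).trans ?_
            linarith [hr.2, hy.2]
          have h5 := (PiLp.norm_apply_le (r • lift y - lift x) i).trans h2
          rw [Real.norm_eq_abs, abs_le, PiLp.sub_apply] at h5
          constructor <;> linarith [h5.1, h5.2, congrFun hl i]
      _ ≤ _ := lintegral_mono_set fun r hr => zero_lt_one.trans hr.1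
  have hfin := hlow.trans hup
  have hreal : (∏ i, (|lift x i| + 3 * θ) ^ (2 * κ i)) * (6 * θ) ^ (d + 1) ≤
      θ * ((6 ^ (d + 1) * ∏ i, (3 : ℝ) ^ (2 * κ i)) * capSize κ x θ) := by
    have h := prod_abs_add_mul_le hκ (fun i => lift x i) (L := 3) (by norm_num) hθ.le
    calc _ ≤ ((∏ i, (3 : ℝ) ^ (2 * κ i)) * ∏ i, (|lift x i| + θ) ^ (2 * κ i)) *
          (6 * θ) ^ (d + 1) := by gcongr
      _ = _ := by
        rw [capSize]
        ring
  have h := hfin.trans (ENNReal.ofReal_le_ofReal hreal)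
  rw [ENNReal.ofReal_mul hθ.le, ENNReal.mul_le_mul_iff_right (by simpa using hθ)
    ENNReal.ofReal_ne_top, ENNReal.ofReal_mul hA0] at h
  convert h using 2
  exact (ENNReal.ofReal_eq_coe_nnreal hA0).symm

theorem measB_inter_B {d : ℕ} (κ : Fin (d + 1) → ℝ) {S : Set (EuclideanSpace ℝ (Fin d))}
    (hS : MeasurableSet S) : measB κ S = measB κ (S ∩ B d) := by
  have hB : MeasurableSet (B d) := measurableSet_closedBall
  rw [measB, withDensity_apply _ hS, withDensity_apply _ (hS.inter hB),
    Measure.restrict_restrict hS, Measure.restrict_restrict (hS.inter hB), inter_assoc, inter_self]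

theorem norm_le_mul_of_forall_abs_le {n : ℕ} {v : EuclideanSpace ℝ (Fin n)} {h : ℝ} (hh : 0 ≤ h)
    (hv : ∀ i, |v i| ≤ h) : ‖v‖ ≤ n * h := by
  refine (sq_le_sq₀ (norm_nonneg _) (by positivity)).1 ?_
  rw [EuclideanSpace.norm_sq_eq]
  calc ∑ i, ‖v i‖ ^ 2 ≤ ∑ _i : Fin n, h ^ 2 := by
        refine Finset.sum_le_sum fun i _ => ?_
        rw [Real.norm_eq_abs]
        gcongr
        exact hv i
    _ = n * h ^ 2 := by simp
    _ ≤ (n * h) ^ 2 := by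
        rw [mul_pow]
        gcongr
        exact_mod_cast Nat.le_self_pow two_ne_zero n

/-- A cube of edge h = θ/L close to X, pushed away from the coordinate hyperplanes so that |t_i| ≥
|X_i| + h on it, projects radially into the cap. Its weight is therefore at least ∏ (|X_i| +
h)^(2κ_i). -/
theorem le_measB_capB {d : ℕ} (hd : 1 ≤ d) {κ : Fin (d + 1) → ℝ} (hκ : ∀ i, 0 ≤ κ i) :
    ∃ A : ℝ≥0, ∀ x ∈ B d, ∀ θ : ℝ, 0 < θ → θ ≤ Real.pi →
      ENNReal.ofReal (capSize κ x θ) ≤ A * measB κ (capB x θ) := by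
  -- On the cube each coordinate differs from X_i by at most 2h, so the distance to X is at most (d
  -- + 1) · 2h = θ/4.
  set L : ℝ := 8 * (d + 1) with hL
  have hL1 : 1 ≤ L := by
    have : (0 : ℝ) ≤ d := Nat.cast_nonneg d
    rw [hL]; linarith
  have hL0 : 0 < L := by linarith
  set C : ℝ := L ^ (d + 1) * ∏ i, L ^ (2 * κ i) with hC
  have hC0 : 0 ≤ C := by positivity
  have hA0 : 0 ≤ C * 2 ^ homDim κ := by positivity
  refine ⟨⟨_, hA0⟩, fun x hx θ hθ hπ => ?_⟩
  set h : ℝ := θ / L with hh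
  have hh0 : 0 < h := by positivity
  have hLh : L * h = θ := by rw [hh]; field_simp
  -- The i-th side is (X_i + h, X_i + 2h) or (X_i - 2h, X_i - h), on the side of the sign of X_i.
  -- The last coordinate of X is nonnegative, so the cube stays in the half space.
  set l : Fin (d + 1) → ℝ := fun i => lift x i + if 0 ≤ lift x i then h else -(2 * h) with hl
  have hlow := le_lintegral_coneWeight_cube κ l hh0.le
    (m := fun i => (|lift x i| + h) ^ (2 * κ i)) (fun i => by positivity) (fun i t ht => by
      have := hκ i
      refine Real.rpow_le_rpow (by positivity) ?_ (by positivity)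
      have hli := congrFun hl i
      have ht1 := ht.1
      have ht2 := ht.2
      simp only at hli
      split_ifs at hli with h0
      · rw [abs_of_nonneg h0]
        exact le_trans (by linarith) (le_abs_self t)
      · rw [abs_of_neg (not_le.1 h0)]
        exact le_trans (by linarith) (neg_le_abs t)) (by
      have : 0 ≤ lift x (Fin.last d) := by rw [lift_last]; positivity
      simp only [hl, if_pos this]
      positivity)
  rw [lintegral_coneWeight κ hd (measurableSet_cube l _)] at hlow
  have hmem : ∀ r : ℝ, 0 < r → ∀ y ∈ {y | (r • y, r * √(1 - ‖y‖ ^ 2)) ∈ cube l h} ∩ B d,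
      r ∈ Icc (1 - θ / 4) (1 + θ / 4) ∧ y ∈ capB x θ := by
    intro r hr y hy
    have h1 := mem_cube_smul_iff.1 hy.1
    have h2 : ‖r • lift y - lift x‖ ≤ θ / 4 := by
      have h3 := norm_le_mul_of_forall_abs_le (v := r • lift y - lift x) (h := 2 * h)
        (by positivity) fun i => by
          have hli := congrFun hl i
          have ht1 := (h1 i).1
          have ht2 := (h1 i).2
          simp only at hli
          rw [PiLp.sub_apply, abs_le]
          split_ifs at hli with h0 <;> constructor <;> linarith
      refine h3.trans (le_of_eq ?_)
      rw [← hLh, hL]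
      push_cast
      ring
    have h4 : ‖(r - 1) • lift y‖ ≤ θ / 4 := by
      have h5 := (abs_norm_sub_norm_le (r • lift y) (lift x)).trans h2
      rw [norm_smul, norm_lift hx, norm_lift hy.2, mul_one, Real.norm_of_nonneg hr.le] at h5
      rwa [norm_smul, norm_lift hy.2, mul_one]
    refine ⟨?_, mem_capB_of_norm_le hx hy.2 hθ.le hπ ?_⟩
    · rw [norm_smul, norm_lift hy.2, mul_one, Real.norm_eq_abs, abs_le] at h4
      constructor <;> linarith [h4.1, h4.2]
    · have e : lift x - lift y = (r - 1) • lift y - (r • lift y - lift x) := by module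
      rw [e]
      refine (norm_sub_le _ _).trans ?_
      linarith
  -- Only radii with |r - 1| ≤ θ/4 contribute, an interval of length θ/2; there r ≤ 1 + π/4 < 2,
  -- whence the constant 2 ^ `homDim κ`.
  have hup : ∫⁻ r in Ioi (0 : ℝ), ENNReal.ofReal (r ^ homDim κ) *
      measB κ {y | (r • y, r * √(1 - ‖y‖ ^ 2)) ∈ cube l h} ≤
        ENNReal.ofReal (2 ^ homDim κ) * measB κ (capB x θ) * ENNReal.ofReal θ := by
    calc _ ≤ ∫⁻ r in Ioi (0 : ℝ), (Icc (1 - θ / 4) (1 + θ / 4)).indicator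
          (fun _ => ENNReal.ofReal (2 ^ homDim κ) * measB κ (capB x θ)) r := by
          refine setLIntegral_mono' measurableSet_Ioi fun r hr => ?_
          have hr : 0 < r := hr
          have hS : MeasurableSet {y : EuclideanSpace ℝ (Fin d) |
              (r • y, r * √(1 - ‖y‖ ^ 2)) ∈ cube l h} :=
            (measurableSet_cube l h).preimage (f := fun y => (r • y, r * √(1 - ‖y‖ ^ 2)))
              (by fun_prop)
          rw [measB_inter_B κ hS]
          by_cases hrI : r ∈ Icc (1 - θ / 4) (1 + θ / 4)
          · rw [indicator_of_mem hrI]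
            have hD : 0 ≤ homDim κ := by
              have := Finset.sum_nonneg fun i (_ : i ∈ Finset.univ) => hκ i
              unfold homDim
              positivity
            gcongr
            · linarith [hrI.2, Real.pi_lt_four]
            · exact fun y hy => (hmem r hr y hy).2
          · rw [indicator_of_notMem hrI, (eq_empty_of_forall_notMem fun y hy =>
              hrI (hmem r hr y hy).1 : _ = ∅), measure_empty, mul_zero]
      _ ≤ ∫⁻ r, (Icc (1 - θ / 4) (1 + θ / 4)).indicator
          (fun _ => ENNReal.ofReal (2 ^ homDim κ) * measB κ (capB x θ)) r :=
          setLIntegral_le_lintegral _ _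
      _ ≤ _ := by
          rw [lintegral_indicator_const measurableSet_Icc, Real.volume_Icc]
          gcongr
          linarith
  have hreal : θ * capSize κ x θ ≤ C * ((∏ i, (|lift x i| + h) ^ (2 * κ i)) * h ^ (d + 1)) := by
    have h1 := prod_abs_add_mul_le hκ (fun i => lift x i) (L := L) hL1 hh0.le
    rw [hLh] at h1
    calc θ * capSize κ x θ = (∏ i, (|lift x i| + θ) ^ (2 * κ i)) * (L * h) ^ (d + 1) := by
          rw [capSize, hLh]; ring
      _ ≤ ((∏ i, L ^ (2 * κ i)) * ∏ i, (|lift x i| + h) ^ (2 * κ i)) * (L * h) ^ (d + 1) := by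
          gcongr
      _ = _ := by
        rw [hC, mul_pow]
        generalize ∏ i, (|lift x i| + h) ^ (2 * κ i) = p
        ring
  have hfin : ENNReal.ofReal θ * ENNReal.ofReal (capSize κ x θ) ≤
      ENNReal.ofReal θ * (ENNReal.ofReal (C * 2 ^ homDim κ) * measB κ (capB x θ)) := by
    rw [← ENNReal.ofReal_mul hθ.le]
    refine (ENNReal.ofReal_le_ofReal hreal).trans ?_
    rw [ENNReal.ofReal_mul hC0, ENNReal.ofReal_mul hC0]
    refine (mul_le_mul_right (hlow.trans hup) _).trans (le_of_eq ?_)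
    ring
  rw [ENNReal.mul_le_mul_iff_right (by simpa using hθ) ENNReal.ofReal_ne_top] at hfin
  convert hfin using 2
  exact (ENNReal.ofReal_eq_coe_nnreal hA0).symm

/-! ### The one-dimensional measures of the intertwining operator -/

/-- The factor 1 + t raises the exponent at -1 from k - 1 to k, so the density can be singular only
at 1. -/
theorem vDensity_eq {k t : ℝ} (hk : 0 < k) (ht : t ∈ Icc (-1 : ℝ) 1) :
    vDensity k t = (1 + t) ^ k * (1 - t) ^ (k - 1) := by
  have h1 : 0 ≤ 1 + t := by linarith [ht.1]
  have h2 : 0 ≤ 1 - t := by linarith [ht.2]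
  have h3 : (1 + t) * (1 + t) ^ (k - 1) = (1 + t) ^ k := by
    rcases h1.eq_or_lt with h | h
    · rw [← h, zero_mul, Real.zero_rpow hk.ne']
    · rw [mul_comm, ← Real.rpow_add_one h.ne', sub_add_cancel]
  rw [vDensity, show 1 - t ^ 2 = (1 + t) * (1 - t) by ring, Real.mul_rpow h1 h2, ← mul_assoc, h3]

theorem vDensity_nonneg {k t : ℝ} (ht : t ∈ Icc (-1 : ℝ) 1) : 0 ≤ vDensity k t := by
  have h1 : 0 ≤ 1 + t := by linarith [ht.1]
  have h2 : 0 ≤ 1 - t ^ 2 := by nlinarith [ht.1, ht.2]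
  unfold vDensity
  positivity

theorem vDensity_le {k t δ : ℝ} (hk : 0 < k) (ht : t ∈ Icc (-1 : ℝ) 1) (hδ : 1 + t ≤ δ) :
    vDensity k t ≤ δ ^ k * (1 - t) ^ (k - 1) := by
  have h1 : 0 ≤ 1 + t := by linarith [ht.1]
  have h2 : 0 ≤ 1 - t := by linarith [ht.2]
  rw [vDensity_eq hk ht]
  gcongr

theorem le_vDensity {k t : ℝ} (hk : 0 < k) (ht : t ∈ Icc (0 : ℝ) 1) :
    (1 - t) ^ (k - 1) ≤ vDensity k t := by
  have h2 : 0 ≤ 1 - t := by linarith [ht.2]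
  rw [vDensity_eq hk ⟨by linarith [ht.1], ht.2⟩]
  exact le_mul_of_one_le_left (by positivity) (Real.one_le_rpow (by linarith [ht.1]) hk.le)

@[fun_prop]
theorem measurable_vDensity (k : ℝ) : Measurable (vDensity k) := by
  unfold vDensity
  fun_prop

theorem integrableOn_one_sub_rpow {k : ℝ} (hk : 0 < k) {δ : ℝ} (hδ : 0 ≤ δ) :
    IntegrableOn (fun t : ℝ => (1 - t) ^ (k - 1)) (Icc (1 - δ) 1) := by
  have h : IntervalIntegrable (fun u : ℝ => u ^ (k - 1)) volume 0 δ :=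
    intervalIntegral.intervalIntegrable_rpow' (by linarith)
  have h2 := h.comp_sub_left 1
  rw [sub_zero] at h2
  exact (intervalIntegrable_iff_integrableOn_Icc_of_le (by linarith)).1 h2.symm

theorem lintegral_one_sub_rpow {k : ℝ} (hk : 0 < k) {δ : ℝ} (hδ : 0 ≤ δ) {a : ℝ} (ha : 0 ≤ a) :
    ∫⁻ t in Icc (1 - δ) 1, ENNReal.ofReal (a * (1 - t) ^ (k - 1)) =
      ENNReal.ofReal (a * (δ ^ k / k)) := by
  rw [← ofReal_integral_eq_lintegral_ofReal ((integrableOn_one_sub_rpow hk hδ).const_mul a)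
    ((ae_restrict_iff' measurableSet_Icc).2 (.of_forall fun t ht => by
      have : 0 ≤ 1 - t := by linarith [ht.2]
      show 0 ≤ a * (1 - t) ^ (k - 1)
      positivity)), integral_const_mul,
    integral_Icc_eq_integral_Ioc, ← intervalIntegral.integral_of_le (by linarith),
    intervalIntegral.integral_comp_sub_left (fun u : ℝ => u ^ (k - 1)), sub_self, sub_sub_cancel,
    integral_rpow (Or.inl (by linarith)), sub_add_cancel, Real.zero_rpow hk.ne', sub_zero]

theorem vDensity_integral_pos {k : ℝ} (hk : 0 < k) : 0 < ∫ s in Icc (-1 : ℝ) 1, vDensity k s := by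
  have hint : IntegrableOn (vDensity k) (Icc (-1) 1) := by
    have h := (integrableOn_one_sub_rpow hk (zero_le_two (α := ℝ))).const_mul (2 ^ k)
    rw [show (1 : ℝ) - 2 = -1 by norm_num] at h
    refine h.mono' (measurable_vDensity k).aestronglyMeasurable
      ((ae_restrict_iff' measurableSet_Icc).2 (.of_forall fun t ht => ?_))
    rw [Real.norm_of_nonneg (vDensity_nonneg ht)]
    exact vDensity_le hk ht (by linarith [ht.2])
  have h0 : 0 ≤ᵐ[volume.restrict (Icc (-1 : ℝ) 1)] vDensity k :=
    (ae_restrict_iff' measurableSet_Icc).2 (.of_forall fun t ht => vDensity_nonneg ht)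
  rw [← ENNReal.ofReal_pos, ofReal_integral_eq_lintegral_ofReal hint h0]
  calc (0 : ℝ≥0∞) < ENNReal.ofReal (1 * (1 ^ k / k)) := by
        rw [ENNReal.ofReal_pos]
        positivity
    _ = ∫⁻ t in Icc (1 - 1) 1, ENNReal.ofReal (1 * (1 - t) ^ (k - 1)) :=
        (lintegral_one_sub_rpow hk zero_le_one zero_le_one).symm
    _ ≤ ∫⁻ t in Icc (1 - 1) 1, ENNReal.ofReal (vDensity k t) := by
        refine setLIntegral_mono' measurableSet_Icc fun t ht => ENNReal.ofReal_le_ofReal ?_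
        rw [one_mul]
        exact le_vDensity hk (by simpa using ht)
    _ ≤ _ := lintegral_mono_set (Icc_subset_Icc_left (by norm_num))

theorem vMeasure_apply {k : ℝ} (hk : k ≠ 0) {S : Set ℝ} (hS : MeasurableSet S) :
    vMeasure k S = ∫⁻ t in S ∩ Icc (-1) 1,
      ENNReal.ofReal ((∫ s in Icc (-1 : ℝ) 1, vDensity k s)⁻¹ * vDensity k t) := by
  rw [vMeasure, if_neg hk, withDensity_apply _ hS, Measure.restrict_restrict hS]

theorem vMeasure_compl_Icc (k : ℝ) : vMeasure k (Icc (-1) 1)ᶜ = 0 := by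
  rcases eq_or_ne k 0 with rfl | hk
  · simp [vMeasure]
  · rw [vMeasure_apply hk measurableSet_Icc.compl, compl_inter_self, setLIntegral_empty]

/-- The set has a piece at each endpoint. Near 1, (1 + t)^k ≤ 2^k and (1 - t)^(k - 1) integrates to
δ^k/k. Near -1, (1 + t)^k ≤ δ^k already has the right size, and the other factor is integrated over
all of [-1, 1]. -/
theorem vMeasure_le {k : ℝ} (hk : 0 ≤ k) : ∃ A : ℝ, 0 ≤ A ∧ ∀ δ : ℝ, 0 ≤ δ →
    vMeasure k {t | 1 - |t| ≤ δ} ≤ ENNReal.ofReal (A * δ ^ k) := by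
  rcases hk.eq_or_lt with rfl | hk
  · refine ⟨1, zero_le_one, fun δ _ => ?_⟩
    -- For k = 0 the bound is total mass 1 = δ^0, also at δ = 0 by the convention 0^0 = 1.
    rw [vMeasure, if_pos rfl, Real.rpow_zero, mul_one, ENNReal.ofReal_one]
    exact prob_le_one
  set c := (∫ s in Icc (-1 : ℝ) 1, vDensity k s)⁻¹ with hc
  have hc0 : 0 < c := inv_pos.2 (vDensity_integral_pos hk)
  refine ⟨2 * (c * (2 ^ k / k)), by positivity, fun δ hδ => ?_⟩
  have hS : MeasurableSet {t : ℝ | 1 - |t| ≤ δ} :=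
    measurableSet_le (by fun_prop) measurable_const
  rw [vMeasure_apply hk.ne' hS]
  have hsub : {t : ℝ | 1 - |t| ≤ δ} ∩ Icc (-1) 1 ⊆
      (Icc (1 - δ) 1 ∩ Icc (-1) 1) ∪ (Iic (δ - 1) ∩ Icc (-1) 1) := by
    rintro t ⟨ht, ht1⟩
    have ht : 1 - |t| ≤ δ := ht
    rcases le_total 0 t with h | h
    · rw [abs_of_nonneg h] at ht
      exact .inl ⟨⟨by linarith, ht1.2⟩, ht1⟩
    · rw [abs_of_nonpos h] at ht
      exact .inr ⟨show t ≤ δ - 1 by linarith, ht1⟩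
  have h1 : ∫⁻ t in Icc (1 - δ) 1 ∩ Icc (-1) 1, ENNReal.ofReal (c * vDensity k t) ≤
      ENNReal.ofReal (c * 2 ^ k * (δ ^ k / k)) := by
    rw [← lintegral_one_sub_rpow hk hδ (by positivity)]
    refine (setLIntegral_mono' (measurableSet_Icc.inter measurableSet_Icc) fun t ht => ?_).trans
      (lintegral_mono_set inter_subset_left)
    refine ENNReal.ofReal_le_ofReal ?_
    rw [mul_assoc]
    exact mul_le_mul_of_nonneg_left (vDensity_le hk ht.2 (by linarith [ht.2.2])) hc0.le
  have h2 : ∫⁻ t in Iic (δ - 1) ∩ Icc (-1) 1, ENNReal.ofReal (c * vDensity k t) ≤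
      ENNReal.ofReal (c * δ ^ k * (2 ^ k / k)) := by
    rw [← lintegral_one_sub_rpow hk zero_le_two (by positivity),
      show (1 : ℝ) - 2 = -1 by norm_num]
    refine (setLIntegral_mono' (measurableSet_Iic.inter measurableSet_Icc) fun t ht => ?_).trans
      (lintegral_mono_set inter_subset_right)
    refine ENNReal.ofReal_le_ofReal ?_
    have ht1 : t ≤ δ - 1 := ht.1
    rw [mul_assoc]
    exact mul_le_mul_of_nonneg_left (vDensity_le hk ht.2 (by linarith)) hc0.le
  refine (lintegral_mono_set hsub).trans ((lintegral_union_le _ _ _).trans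
    ((add_le_add h1 h2).trans (le_of_eq ?_)))
  rw [← ENNReal.ofReal_add (by positivity) (by positivity)]
  congr 1
  ring

/-- The window at 1 suffices; δ ≤ 1 keeps it in [0, 1], where the density is at least (1 - t)^(k -
1) up to normalization. -/
theorem le_vMeasure {k : ℝ} (hk : 0 ≤ k) : ∃ a : ℝ, 0 < a ∧ ∀ δ : ℝ, 0 ≤ δ → δ ≤ 1 →
    ENNReal.ofReal (a * δ ^ k) ≤ vMeasure k (Icc (1 - δ) 1) := by
  rcases hk.eq_or_lt with rfl | hk
  · refine ⟨1, zero_lt_one, fun δ h0 _ => ?_⟩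
    rw [vMeasure, if_pos rfl, Real.rpow_zero, mul_one, ENNReal.ofReal_one,
      Measure.dirac_apply_of_mem (show (1 : ℝ) ∈ Icc (1 - δ) 1 from ⟨by linarith, le_rfl⟩)]
  have hc0 := inv_pos.2 (vDensity_integral_pos hk)
  refine ⟨(∫ s in Icc (-1 : ℝ) 1, vDensity k s)⁻¹ * (1 / k), by positivity, fun δ h0 h1 => ?_⟩
  rw [vMeasure_apply hk.ne' measurableSet_Icc,
    inter_eq_left.2 (Icc_subset_Icc_left (by linarith)), mul_assoc, one_div_mul_eq_div,
    ← lintegral_one_sub_rpow hk h0 hc0.le]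
  refine setLIntegral_mono' measurableSet_Icc fun t ht => ENNReal.ofReal_le_ofReal ?_
  exact mul_le_mul_of_nonneg_left (le_vDensity hk ⟨by linarith [ht.1], ht.2⟩) hc0.le

theorem isFiniteMeasure_vMeasure {k : ℝ} (hk : 0 ≤ k) : IsFiniteMeasure (vMeasure k) := by
  obtain ⟨A, -, hA⟩ := vMeasure_le hk
  refine ⟨lt_of_le_of_lt ?_ (ENNReal.ofReal_lt_top (r := A * 1 ^ k))⟩
  refine (measure_mono fun t _ => ?_).trans (hA 1 zero_le_one)
  show 1 - |t| ≤ 1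
  linarith [abs_nonneg t]

/-! ### Two-sided estimate for the kernel -/

theorem mem_e_iff {d : ℕ} {x : EuclideanSpace ℝ (Fin d)} {θ : ℝ}
    {z : EuclideanSpace ℝ (Fin (d + 1))} :
    z ∈ e x θ ↔ z ∈ B (d + 1) ∧ Real.cos θ ≤ ∑ i, lift x i * z i ∧ 0 ≤ z (Fin.last d) := by
  simp only [Fin.sum_univ_castSucc, lift_castSucc, lift_last]
  rfl

theorem isClosed_e {d : ℕ} (x : EuclideanSpace ℝ (Fin d)) (θ : ℝ) : IsClosed (e x θ) := by
  have h1 : IsClosed {z : EuclideanSpace ℝ (Fin (d + 1)) | Real.cos θ ≤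
      (∑ i : Fin d, x i * z i.castSucc) + √(1 - ‖x‖ ^ 2) * z (Fin.last d)} :=
    isClosed_le (by fun_prop) (by fun_prop)
  have h2 : IsClosed {z : EuclideanSpace ℝ (Fin (d + 1)) | 0 ≤ z (Fin.last d)} :=
    isClosed_le (by fun_prop) (by fun_prop)
  exact Metric.isClosed_closedBall.inter (h1.inter h2)

/-- The set of `t` for which the dilation of `z` by `t` lies in `e x θ`. -/
def dilationSet {d : ℕ} (x : EuclideanSpace ℝ (Fin d)) (θ : ℝ)
    (z : EuclideanSpace ℝ (Fin (d + 1))) : Set (Fin (d + 1) → ℝ) :=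
  {t | WithLp.toLp 2 (fun i => z i * t i) ∈ e x θ}

theorem V_indicator_e {d : ℕ} (κ : Fin (d + 1) → ℝ) (x : EuclideanSpace ℝ (Fin d)) (θ : ℝ)
    (z : EuclideanSpace ℝ (Fin (d + 1))) :
    V κ ((e x θ).indicator fun _ => 1) z =
      (Measure.pi fun i => vMeasure (κ i)).real (dilationSet x θ z) := by
  have hm : MeasurableSet (dilationSet x θ z) :=
    ((isClosed_e x θ).preimage (f := fun t : Fin (d + 1) → ℝ =>
      (WithLp.toLp 2 (fun i => z i * t i) : EuclideanSpace ℝ (Fin (d + 1))))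
      ((PiLp.continuous_toLp 2 _).comp (by fun_prop))).measurableSet
  rw [V, ← integral_indicator_one hm]
  rfl

theorem ofReal_V_indicator_e {d : ℕ} {κ : Fin (d + 1) → ℝ} (hκ : ∀ i, 0 ≤ κ i)
    (x : EuclideanSpace ℝ (Fin d)) (θ : ℝ) (z : EuclideanSpace ℝ (Fin (d + 1))) :
    ENNReal.ofReal (V κ ((e x θ).indicator fun _ => 1) z) =
      (Measure.pi fun i => vMeasure (κ i)) (dilationSet x θ z) := by
  have := fun i => isFiniteMeasure_vMeasure (hκ i)
  rw [V_indicator_e, ofReal_measureReal]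

/-- The squared ratio `(θ / (|Xᵢ| + θ))²`. -/
noncomputable def capRatio {d : ℕ} (x : EuclideanSpace ℝ (Fin d)) (θ : ℝ) (i : Fin (d + 1)) : ℝ :=
  (θ / (|lift x i| + θ)) ^ 2

theorem capRatio_pos {d : ℕ} (x : EuclideanSpace ℝ (Fin d)) {θ : ℝ} (hθ : 0 < θ)
    (i : Fin (d + 1)) : 0 < capRatio x θ i := by
  unfold capRatio
  positivity

theorem capRatio_le_one {d : ℕ} (x : EuclideanSpace ℝ (Fin d)) {θ : ℝ} (hθ : 0 < θ)
    (i : Fin (d + 1)) : capRatio x θ i ≤ 1 := by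
  refine pow_le_one₀ (by positivity) ((div_le_one (by positivity)).2 ?_)
  linarith [abs_nonneg (lift x i)]

/-- The size `∏ (θ / (|Xᵢ| + θ)) ^ (2 κᵢ)` of the kernel. -/
noncomputable def kernelSize {d : ℕ} (κ : Fin (d + 1) → ℝ) (x : EuclideanSpace ℝ (Fin d)) (θ : ℝ) :
    ℝ :=
  ∏ i, capRatio x θ i ^ κ i

theorem sum_abs_lift_sq {d : ℕ} {x : EuclideanSpace ℝ (Fin d)} (hx : x ∈ B d) :
    ∑ i, |lift x i| ^ 2 = 1 := by
  have h := EuclideanSpace.norm_sq_eq (lift x)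
  rw [norm_lift hx, one_pow] at h
  exact h.symm

theorem signAct_apply {d : ℕ} (x : EuclideanSpace ℝ (Fin d)) (ε : Fin d → ℤˣ) (i : Fin d) :
    signAct x ε i = x i * ((ε i : ℤ) : ℝ) := rfl

theorem abs_signAct_apply {d : ℕ} (x : EuclideanSpace ℝ (Fin d)) (ε : Fin d → ℤˣ) (i : Fin d) :
    |signAct x ε i| = |x i| := by
  rw [signAct_apply]
  rcases Int.units_eq_one_or (ε i) with h | h <;> simp [h]

theorem norm_signAct {d : ℕ} (x : EuclideanSpace ℝ (Fin d)) (ε : Fin d → ℤˣ) :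
    ‖signAct x ε‖ = ‖x‖ := by
  rw [EuclideanSpace.norm_eq, EuclideanSpace.norm_eq]
  simp only [Real.norm_eq_abs, abs_signAct_apply]

theorem signAct_mem_B {d : ℕ} {x : EuclideanSpace ℝ (Fin d)} (hx : x ∈ B d) (ε : Fin d → ℤˣ) :
    signAct x ε ∈ B d := by
  rw [mem_closedBall_zero_iff, norm_signAct]
  exact mem_closedBall_zero_iff.1 hx

theorem abs_lift_signAct {d : ℕ} (x : EuclideanSpace ℝ (Fin d)) (ε : Fin d → ℤˣ)
    (i : Fin (d + 1)) : |lift (signAct x ε) i| = |lift x i| := by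
  refine Fin.lastCases ?_ (fun i => ?_) i
  · rw [lift_last, lift_last, norm_signAct]
  · rw [lift_castSucc, lift_castSucc, abs_signAct_apply]

/-- The signs make every x_i y_i nonnegative. The last coordinates of the lifts are nonnegative
already, so d signs are enough. -/
theorem exists_inner_lift_signAct {d : ℕ} (x y : EuclideanSpace ℝ (Fin d)) :
    ∃ ε : Fin d → ℤˣ,
      inner ℝ (lift (signAct x ε)) (lift y) = ∑ i, |lift x i| * |lift y i| := by
  refine ⟨fun i => if 0 ≤ x i * y i then 1 else -1, ?_⟩
  rw [inner_lift, norm_signAct, Fin.sum_univ_castSucc, lift_last, lift_last,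
    abs_of_nonneg (Real.sqrt_nonneg _), abs_of_nonneg (Real.sqrt_nonneg _), PiLp.inner_apply]
  congr 1
  refine Finset.sum_congr rfl fun i _ => ?_
  rw [lift_castSucc, lift_castSucc, ← abs_mul, signAct_apply]
  split_ifs with h
  · rw [abs_of_nonneg h]
    simp [mul_comm]
  · rw [abs_of_neg (not_le.1 h)]
    simp [mul_comm]

/-- Assuming only |z_i| = |Y_i| covers both Y and its reflection, the two points occurring in `VB`.
-/
theorem cos_le_sum_of_mem_dilationSet {d : ℕ} {x y : EuclideanSpace ℝ (Fin d)} {θ : ℝ}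
    {z : EuclideanSpace ℝ (Fin (d + 1))} (hz : ∀ i, |z i| = |lift y i|) {t : Fin (d + 1) → ℝ}
    (ht : t ∈ dilationSet x θ z) :
    Real.cos θ ≤ ∑ i, |lift x i| * |lift y i| * |t i| := by
  refine (mem_e_iff.1 ht).2.1.trans (Finset.sum_le_sum fun i _ => ?_)
  rw [← hz i, ← abs_mul, ← abs_mul, mul_assoc]
  exact le_abs_self _

theorem exists_mem_capB_of_mem_dilationSet {d : ℕ} {x y : EuclideanSpace ℝ (Fin d)} (hx : x ∈ B d)
    (hy : y ∈ B d) {θ : ℝ} (h0 : 0 ≤ θ) (hπ : θ ≤ Real.pi) {z : EuclideanSpace ℝ (Fin (d + 1))}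
    (hz : ∀ i, |z i| = |lift y i|) {t : Fin (d + 1) → ℝ} (ht : t ∈ dilationSet x θ z)
    (ht1 : ∀ i, |t i| ≤ 1) : ∃ ε, y ∈ capB (signAct x ε) θ := by
  obtain ⟨ε, hε⟩ := exists_inner_lift_signAct x y
  refine ⟨ε, (mem_capB_iff (signAct_mem_B hx ε) hy h0 hπ).2 ?_⟩
  rw [hε]
  refine (cos_le_sum_of_mem_dilationSet hz ht).trans (Finset.sum_le_sum fun i _ => ?_)
  exact mul_le_of_le_one_right (by positivity) (ht1 i)

/-- Since X and Y are unit vectors, 1 - ∑ |X_j||Y_j||t_j| = ½ ∑ (|X_j| - |Y_j|)² + ∑ |X_j||Y_j|(1 -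
|t_j|). The left side is at most 1 - cos θ ≤ θ²/2 and all terms on the right are nonnegative, so
each one is bounded separately. -/
theorem one_sub_abs_le_of_mem_dilationSet {d : ℕ} {x y : EuclideanSpace ℝ (Fin d)} (hx : x ∈ B d)
    (hy : y ∈ B d) {θ : ℝ} (h0 : 0 < θ) {z : EuclideanSpace ℝ (Fin (d + 1))}
    (hz : ∀ i, |z i| = |lift y i|) {t : Fin (d + 1) → ℝ} (ht : t ∈ dilationSet x θ z)
    (ht1 : ∀ i, |t i| ≤ 1) (i : Fin (d + 1)) : 1 - |t i| ≤ 18 * capRatio x θ i := by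
  have hcos := cos_le_sum_of_mem_dilationSet hz ht
  have hcos2 := Real.one_sub_sq_div_two_le_cos (x := θ)
  have hsx := sum_abs_lift_sq hx
  have hsy := sum_abs_lift_sq hy
  have hnn : ∀ j, 0 ≤ |lift x j| * |lift y j| * (1 - |t j|) := fun j =>
    mul_nonneg (by positivity) (sub_nonneg.2 (ht1 j))
  have hexp : ∑ j, (|lift x j| - |lift y j|) ^ 2 =
      2 - 2 * ∑ j, |lift x j| * |lift y j| := by
    rw [Finset.mul_sum]
    have : ∀ j, (|lift x j| - |lift y j|) ^ 2 =
        |lift x j| ^ 2 + |lift y j| ^ 2 - 2 * (|lift x j| * |lift y j|) := fun j => by ring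
    simp_rw [this]
    rw [Finset.sum_sub_distrib, Finset.sum_add_distrib, hsx, hsy]
    norm_num
  have hsum : ∑ j, |lift x j| * |lift y j| * (1 - |t j|) =
      ∑ j, |lift x j| * |lift y j| - ∑ j, |lift x j| * |lift y j| * |t j| := by
    rw [← Finset.sum_sub_distrib]
    exact Finset.sum_congr rfl fun j _ => by ring
  have h1 := Finset.single_le_sum (fun j _ => sq_nonneg (|lift x j| - |lift y j|))
    (Finset.mem_univ i)
  have h2 := Finset.single_le_sum (fun j _ => hnn j) (Finset.mem_univ i)
  have hP : 0 ≤ ∑ j, (|lift x j| - |lift y j|) ^ 2 := Finset.sum_nonneg fun j _ => sq_nonneg _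
  have hS : 0 ≤ ∑ j, |lift x j| * |lift y j| * (1 - |t j|) := Finset.sum_nonneg fun j _ => hnn j
  have h3 : (|lift x i| - |lift y i|) ^ 2 ≤ θ ^ 2 := by linarith
  have h4 : |lift x i| * |lift y i| * (1 - |t i|) ≤ θ ^ 2 / 2 := by linarith
  have h5 := (abs_le_of_sq_le_sq' h3 h0.le).2
  have hs0 : 0 ≤ 1 - |t i| := sub_nonneg.2 (ht1 i)
  have hs1 : 1 - |t i| ≤ 1 := by linarith [abs_nonneg (t i)]
  have ha := abs_nonneg (lift x i)
  generalize hga : |lift x i| = a at *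
  generalize |lift y i| = b at *
  generalize 1 - |t i| = s at *
  rw [capRatio, hga, div_pow, ← mul_div_assoc, le_div_iff₀ (by positivity)]
  -- If a ≤ 2θ the ratio is at least 1/9 and s ≤ 1 suffices. Otherwise b ≥ a - θ ≥ a/2, so a²s ≤ θ²,
  -- while a + θ ≤ 3a/2.
  rcases le_total a (2 * θ) with h | h
  · have : (a + θ) ^ 2 ≤ (3 * θ) ^ 2 := by gcongr; linarith
    nlinarith [mul_le_mul hs1 this (by positivity) zero_le_one]
  · have hb : a / 2 ≤ b := by linarith
    have h6 : a * (a / 2) * s ≤ θ ^ 2 / 2 := le_trans (by gcongr) h4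
    have h7 : (a + θ) ^ 2 ≤ (3 / 2 * a) ^ 2 := by gcongr; linarith
    nlinarith [mul_le_mul_of_nonneg_left h7 hs0, sq_nonneg θ]

theorem pi_vMeasure_ae_abs_le_one {n : ℕ} {κ : Fin n → ℝ} (hκ : ∀ i, 0 ≤ κ i) :
    ∀ᵐ t ∂(Measure.pi fun i => vMeasure (κ i)), ∀ i, |t i| ≤ 1 := by
  have := fun i => isFiniteMeasure_vMeasure (hκ i)
  refine ae_all_iff.2 fun i => ?_
  have h : ∀ᵐ s ∂(vMeasure (κ i)), |s| ≤ 1 := by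
    rw [ae_iff]
    refine measure_mono_null (fun s hs => ?_) (vMeasure_compl_Icc (κ i))
    exact fun h => hs (abs_le.2 h)
  exact (Measure.tendsto_eval_ae_ae (μ := fun i => vMeasure (κ i)) (i := i)).eventually h

theorem pi_dilationSet_eq_zero {d : ℕ} {κ : Fin (d + 1) → ℝ} (hκ : ∀ i, 0 ≤ κ i)
    {x y : EuclideanSpace ℝ (Fin d)} (hx : x ∈ B d) (hy : y ∈ B d) {θ : ℝ} (h0 : 0 ≤ θ)
    (hπ : θ ≤ Real.pi) {z : EuclideanSpace ℝ (Fin (d + 1))} (hz : ∀ i, |z i| = |lift y i|)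
    (h : ∀ ε, y ∉ capB (signAct x ε) θ) :
    (Measure.pi fun i => vMeasure (κ i)) (dilationSet x θ z) = 0 := by
  refine measure_mono_null ?_ (ae_iff.1 (pi_vMeasure_ae_abs_le_one hκ))
  intro t ht h1
  obtain ⟨ε, hε⟩ := exists_mem_capB_of_mem_dilationSet hx hy h0 hπ hz ht h1
  exact h ε hε

/-- Up to a null set the dilation set lies in a box, whose product measure factorizes into
one-dimensional windows. -/
theorem pi_dilationSet_le {d : ℕ} {κ : Fin (d + 1) → ℝ} (hκ : ∀ i, 0 ≤ κ i) :
    ∃ C : ℝ≥0, ∀ x ∈ B d, ∀ y ∈ B d, ∀ θ : ℝ, 0 < θ →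
      ∀ z : EuclideanSpace ℝ (Fin (d + 1)), (∀ i, |z i| = |lift y i|) →
        (Measure.pi fun i => vMeasure (κ i)) (dilationSet x θ z) ≤
          C * ENNReal.ofReal (kernelSize κ x θ) := by
  have := fun i => isFiniteMeasure_vMeasure (hκ i)
  choose A hA0 hA using fun i => vMeasure_le (hκ i)
  have hC0 : 0 ≤ ∏ i, A i * 18 ^ κ i :=
    Finset.prod_nonneg fun i _ => mul_nonneg (hA0 i) (by positivity)
  refine ⟨⟨_, hC0⟩, fun x hx y hy θ hθ z hz => ?_⟩
  have hρ := fun i => capRatio_pos x hθ i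
  calc (Measure.pi fun i => vMeasure (κ i)) (dilationSet x θ z)
      ≤ (Measure.pi fun i => vMeasure (κ i))
          (univ.pi fun i => {t | 1 - |t| ≤ 18 * capRatio x θ i}) := by
        refine measure_mono_ae ?_
        filter_upwards [pi_vMeasure_ae_abs_le_one hκ] with t ht1 ht
        exact fun i _ => one_sub_abs_le_of_mem_dilationSet hx hy hθ hz ht ht1 i
    _ ≤ ∏ i, ENNReal.ofReal (A i * (18 * capRatio x θ i) ^ κ i) := by
        rw [Measure.pi_pi]
        exact Finset.prod_le_prod' fun i _ => hA i _ (by have := hρ i; positivity)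
    _ = ENNReal.ofReal ((∏ i, A i * 18 ^ κ i) * kernelSize κ x θ) := by
        rw [← ENNReal.ofReal_prod_of_nonneg fun i _ =>
          mul_nonneg (hA0 i) (by have := hρ i; positivity), kernelSize, ← Finset.prod_mul_distrib]
        congr 1
        refine Finset.prod_congr rfl fun i _ => ?_
        rw [Real.mul_rpow (by norm_num) (hρ i).le, mul_assoc]
    _ = _ := by
        rw [ENNReal.ofReal_mul hC0]
        congr 1
        exact ENNReal.ofReal_eq_coe_nnreal hC0

/-- The quarter cap gives ⟨X, Y⟩ ≥ cos(θ/4) ≥ 1 - θ²/32. As |Y_i| ≤ |X_i| + θ, shrinking one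
coordinate costs at most θ²/(16(d + 1)), in all θ²/16. The total loss 3θ²/32 stays below θ²/8 ≤ 1 -
cos θ. -/
theorem mem_dilationSet_of_forall_le {d : ℕ} {x y : EuclideanSpace ℝ (Fin d)} (hx : x ∈ B d)
    {θ : ℝ} (h0 : 0 < θ) (hπ : θ ≤ Real.pi) (hy : y ∈ capB x (θ / 4)) {t : Fin (d + 1) → ℝ}
    (ht : ∀ i, t i ∈ Icc (1 - (16 * (d + 1 : ℝ))⁻¹ * capRatio x θ i) 1) :
    t ∈ dilationSet x θ (lift y) := by
  have hyB : y ∈ B d := hy.1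
  have hd0 : (0 : ℝ) ≤ d := Nat.cast_nonneg d
  have hc1 : (16 * (d + 1 : ℝ))⁻¹ ≤ 1 := inv_le_one_of_one_le₀ (by linarith)
  have hc0 : 0 < (16 * (d + 1 : ℝ))⁻¹ := by positivity
  have ht0 : ∀ i, 0 ≤ t i := fun i => by
    have := mul_le_one₀ hc1 (capRatio_pos x h0 i).le (capRatio_le_one x h0 i)
    linarith [(ht i).1]
  have hterm : ∀ i, lift x i * lift y i - (16 * (d + 1 : ℝ))⁻¹ * θ ^ 2 ≤
      lift x i * (lift y i * t i) := by
    intro i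
    have h1 : |lift y i| ≤ |lift x i| + θ := by
      have h2 := (PiLp.norm_apply_le (lift x - lift y) i).trans (norm_lift_sub_lift_le hx hyB)
      rw [Real.norm_eq_abs, PiLp.sub_apply, abs_sub_comm] at h2
      have h3 := abs_sub_abs_le_abs_sub (lift y i) (lift x i)
      linarith [hy.2]
    have h2 : |lift x i| * |lift y i| * capRatio x θ i ≤ θ ^ 2 := by
      have h3 : |lift x i| * |lift y i| ≤ (|lift x i| + θ) ^ 2 := by
        rw [sq]
        exact mul_le_mul (by linarith) h1 (abs_nonneg _) (by positivity)
      rw [capRatio, div_pow, ← mul_div_assoc, div_le_iff₀ (by positivity), mul_comm (θ ^ 2)]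
      gcongr
    have h3 : lift x i * lift y i * (1 - t i) ≤ (16 * (d + 1 : ℝ))⁻¹ * θ ^ 2 := by
      calc lift x i * lift y i * (1 - t i)
          ≤ |lift x i| * |lift y i| * ((16 * (d + 1 : ℝ))⁻¹ * capRatio x θ i) := by
            rw [← abs_mul]
            exact mul_le_mul (le_abs_self _) (by linarith [(ht i).1]) (by linarith [(ht i).2])
              (abs_nonneg _)
        _ = (16 * (d + 1 : ℝ))⁻¹ * (|lift x i| * |lift y i| * capRatio x θ i) := by ring
        _ ≤ _ := by gcongr
    linarith
  refine mem_e_iff.2 ⟨?_, ?_, ?_⟩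
  · rw [mem_closedBall_zero_iff, ← norm_lift hyB, EuclideanSpace.norm_eq, EuclideanSpace.norm_eq]
    refine Real.sqrt_le_sqrt (Finset.sum_le_sum fun i _ => ?_)
    rw [norm_mul, Real.norm_of_nonneg (ht0 i)]
    exact pow_le_pow_left₀ (mul_nonneg (norm_nonneg _) (ht0 i))
      (mul_le_of_le_one_right (norm_nonneg _) (ht i).2) 2
  · have hsum := Finset.sum_le_sum fun i (_ : i ∈ Finset.univ) => hterm i
    have hin : ∑ i, lift x i * lift y i = inner ℝ (lift x) (lift y) := by
      rw [PiLp.inner_apply]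
      exact Finset.sum_congr rfl fun i _ => by simp [mul_comm]
    rw [Finset.sum_sub_distrib, hin, Finset.sum_const, Finset.card_univ, Fintype.card_fin,
      nsmul_eq_mul] at hsum
    have h1 := (mem_capB_iff hx hyB (by positivity) (by linarith)).1 hy
    have h2 := Real.one_sub_sq_div_two_le_cos (x := θ / 4)
    have h3 := Real.cos_le_one_sub_mul_cos_sq (x := θ) (by rwa [abs_of_pos h0])
    have h4 : 1 / 8 ≤ 2 / Real.pi ^ 2 := by
      rw [div_le_div_iff₀ (by norm_num) (by positivity)]
      nlinarith [Real.pi_pos, Real.pi_lt_four]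
    have h5 : ((d + 1 : ℕ) : ℝ) * ((16 * (d + 1 : ℝ))⁻¹ * θ ^ 2) = θ ^ 2 / 16 := by
      push_cast
      field_simp
    have h6 := mul_le_mul_of_nonneg_right h4 (sq_nonneg θ)
    have h7 : 0 ≤ θ ^ 2 := sq_nonneg θ
    refine le_trans ?_ hsum
    rw [h5]
    linarith
  · exact mul_nonneg (by rw [lift_last]; positivity) (ht0 _)

theorem le_pi_dilationSet {d : ℕ} {κ : Fin (d + 1) → ℝ} (hκ : ∀ i, 0 ≤ κ i) :
    ∃ C : ℝ≥0, ∀ x ∈ B d, ∀ θ : ℝ, 0 < θ → θ ≤ Real.pi → ∀ y ∈ capB x (θ / 4),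
      ENNReal.ofReal (kernelSize κ x θ) ≤
        C * (Measure.pi fun i => vMeasure (κ i)) (dilationSet x θ (lift y)) := by
  have := fun i => isFiniteMeasure_vMeasure (hκ i)
  choose a ha0 ha using fun i => le_vMeasure (hκ i)
  set c : ℝ := (16 * (d + 1 : ℝ))⁻¹ with hc
  have hc0 : 0 < c := by positivity
  have hc1 : c ≤ 1 := inv_le_one_of_one_le₀ (by
    have : (0 : ℝ) ≤ d := Nat.cast_nonneg d
    linarith)
  have hp : 0 < ∏ i, a i * c ^ κ i :=
    Finset.prod_pos fun i _ => mul_pos (ha0 i) (by positivity)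
  refine ⟨⟨(∏ i, a i * c ^ κ i)⁻¹, (inv_pos.2 hp).le⟩, fun x hx θ hθ hπ y hy => ?_⟩
  have hρ := fun i => capRatio_pos x hθ i
  have h : ENNReal.ofReal ((∏ i, a i * c ^ κ i) * kernelSize κ x θ) ≤
      (Measure.pi fun i => vMeasure (κ i)) (dilationSet x θ (lift y)) := by
    calc _ = ∏ i, ENNReal.ofReal (a i * (c * capRatio x θ i) ^ κ i) := by
          rw [← ENNReal.ofReal_prod_of_nonneg fun i _ =>
            mul_nonneg (ha0 i).le (by have := hρ i; positivity), kernelSize,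
            ← Finset.prod_mul_distrib]
          congr 1
          refine Finset.prod_congr rfl fun i _ => ?_
          rw [Real.mul_rpow hc0.le (hρ i).le, mul_assoc]
      _ ≤ ∏ i, vMeasure (κ i) (Icc (1 - c * capRatio x θ i) 1) :=
          Finset.prod_le_prod' fun i _ => ha i _ (by have := hρ i; positivity)
            (mul_le_one₀ hc1 (hρ i).le (capRatio_le_one x hθ i))
      _ = (Measure.pi fun i => vMeasure (κ i))
            (univ.pi fun i => Icc (1 - c * capRatio x θ i) 1) := (Measure.pi_pi _ _).symm
      _ ≤ _ := measure_mono fun t ht =>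
          mem_dilationSet_of_forall_le hx hθ hπ hy fun i => ht i (mem_univ i)
  calc ENNReal.ofReal (kernelSize κ x θ)
      = ENNReal.ofReal (∏ i, a i * c ^ κ i)⁻¹ *
          ENNReal.ofReal ((∏ i, a i * c ^ κ i) * kernelSize κ x θ) := by
        rw [← ENNReal.ofReal_mul (inv_pos.2 hp).le, inv_mul_cancel_left₀ hp.ne']
    _ ≤ ENNReal.ofReal (∏ i, a i * c ^ κ i)⁻¹ *
          (Measure.pi fun i => vMeasure (κ i)) (dilationSet x θ (lift y)) := mul_le_mul_right h _
    _ = _ := by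
        congr 1
        exact ENNReal.ofReal_eq_coe_nnreal (inv_pos.2 hp).le

theorem ofReal_kernelB {d : ℕ} {κ : Fin (d + 1) → ℝ} (hκ : ∀ i, 0 ≤ κ i)
    (x : EuclideanSpace ℝ (Fin d)) (θ : ℝ) (y : EuclideanSpace ℝ (Fin d)) :
    ENNReal.ofReal (kernelB κ x θ y) = ENNReal.ofReal (1 / 2) *
      ((Measure.pi fun i => vMeasure (κ i)) (dilationSet x θ (lift y)) +
        (Measure.pi fun i => vMeasure (κ i)) (dilationSet x θ (flipLast (lift y)))) := by
  rw [← ofReal_V_indicator_e hκ, ← ofReal_V_indicator_e hκ, kernelB, VB,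
    ENNReal.ofReal_mul (by norm_num), ENNReal.ofReal_add] <;>
  · rw [V_indicator_e]
    exact measureReal_nonneg

theorem abs_flipLast_apply {d : ℕ} (z : EuclideanSpace ℝ (Fin (d + 1))) (i : Fin (d + 1)) :
    |flipLast z i| = |z i| := by
  simp only [flipLast]
  split_ifs <;> simp

theorem ofReal_kernelB_le {d : ℕ} {κ : Fin (d + 1) → ℝ} (hκ : ∀ i, 0 ≤ κ i) :
    ∃ C : ℝ≥0, ∀ x ∈ B d, ∀ y ∈ B d, ∀ θ : ℝ, 0 < θ → θ ≤ Real.pi →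
      ENNReal.ofReal (kernelB κ x θ y) ≤
        (⋃ ε, capB (signAct x ε) θ).indicator
          (fun _ => C * ENNReal.ofReal (kernelSize κ x θ)) y := by
  obtain ⟨C, hC⟩ := pi_dilationSet_le hκ
  refine ⟨C, fun x hx y hy θ h0 hπ => ?_⟩
  rw [ofReal_kernelB hκ]
  by_cases h : y ∈ ⋃ ε, capB (signAct x ε) θ
  · rw [indicator_of_mem h]
    refine (mul_le_mul_right (add_le_add (hC x hx y hy θ h0 _ fun i => rfl)
      (hC x hx y hy θ h0 _ fun i => abs_flipLast_apply _ i)) _).trans (le_of_eq ?_)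
    rw [← two_mul, ← mul_assoc, ← ENNReal.ofReal_ofNat 2, ← ENNReal.ofReal_mul (by norm_num)]
    norm_num
  · simp only [mem_iUnion, not_exists] at h
    rw [pi_dilationSet_eq_zero hκ hx hy h0.le hπ (fun i => rfl) h,
      pi_dilationSet_eq_zero hκ hx hy h0.le hπ (fun i => abs_flipLast_apply _ i) h, add_zero,
      mul_zero]
    exact zero_le

/-- The unreflected half of `VB` is enough; dropping the other nonnegative half costs the factor 2.
-/
theorem le_ofReal_kernelB {d : ℕ} {κ : Fin (d + 1) → ℝ} (hκ : ∀ i, 0 ≤ κ i) :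
    ∃ C : ℝ≥0, ∀ x ∈ B d, ∀ θ : ℝ, 0 < θ → θ ≤ Real.pi → ∀ y ∈ capB x (θ / 4),
      ENNReal.ofReal (kernelSize κ x θ) ≤ C * ENNReal.ofReal (kernelB κ x θ y) := by
  obtain ⟨C, hC⟩ := le_pi_dilationSet hκ
  refine ⟨2 * C, fun x hx θ h0 hπ y hy => (hC x hx θ h0 hπ y hy).trans ?_⟩
  rw [ofReal_kernelB hκ]
  have h2 : (2 : ℝ≥0∞) * ENNReal.ofReal (1 / 2) = 1 := by
    rw [← ENNReal.ofReal_ofNat 2, ← ENNReal.ofReal_mul (by norm_num)]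
    norm_num
  rw [ENNReal.coe_mul, ENNReal.coe_ofNat, mul_comm (2 : ℝ≥0∞), mul_assoc, ← mul_assoc 2, h2,
    one_mul]
  gcongr
  exact le_self_add

/-! ### Doubling and the comparison of the maximal functions -/

theorem measB_capB_pos {d : ℕ} (hd : 1 ≤ d) {κ : Fin (d + 1) → ℝ} (hκ : ∀ i, 0 ≤ κ i)
    {x : EuclideanSpace ℝ (Fin d)} (hx : x ∈ B d) {θ : ℝ} (hθ : 0 < θ) :
    0 < measB κ (capB x θ) := by
  obtain ⟨A, hA⟩ := le_measB_capB hd hκ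
  have hmin : 0 < min θ Real.pi := lt_min hθ Real.pi_pos
  have h := hA x hx _ hmin (min_le_right _ _)
  have h0 : 0 < ENNReal.ofReal (capSize κ x (min θ Real.pi)) :=
    ENNReal.ofReal_pos.2 (capSize_pos κ x hmin)
  refine (pos_iff_ne_zero.2 fun h1 => ?_ : 0 < measB κ (capB x (min θ Real.pi))).trans_le
    (measure_mono fun y hy => ⟨hy.1, hy.2.trans (min_le_left _ _)⟩)
  rw [h1, mul_zero] at h
  exact absurd h0 h.not_gt

theorem measB_capB_lt_top {d : ℕ} (hd : 1 ≤ d) {κ : Fin (d + 1) → ℝ} (hκ : ∀ i, 0 ≤ κ i)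
    {x : EuclideanSpace ℝ (Fin d)} (hx : x ∈ B d) {θ : ℝ} (hθ : 0 < θ) :
    measB κ (capB x θ) < ∞ := by
  obtain ⟨A, hA⟩ := measB_capB_le hd hκ
  exact (hA x hx θ hθ).trans_lt (ENNReal.mul_lt_top ENNReal.coe_lt_top ENNReal.ofReal_lt_top)

/-- Caps about points which agree up to signs have comparable measures. -/
theorem measB_capB_four_mul_le {d : ℕ} (hd : 1 ≤ d) {κ : Fin (d + 1) → ℝ} (hκ : ∀ i, 0 ≤ κ i) :
    ∃ C : ℝ≥0, ∀ x ∈ B d, ∀ x' ∈ B d, (∀ i, |lift x' i| = |lift x i|) →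
      ∀ θ : ℝ, 0 < θ → θ ≤ Real.pi →
        measB κ (capB x' (4 * θ)) ≤ C * measB κ (capB x θ) := by
  obtain ⟨A, hA⟩ := measB_capB_le hd hκ
  obtain ⟨A', hA'⟩ := le_measB_capB hd hκ
  have hL0 : 0 ≤ (4 : ℝ) ^ d * ∏ i, (4 : ℝ) ^ (2 * κ i) := by positivity
  refine ⟨A * (((4 : ℝ) ^ d * ∏ i, (4 : ℝ) ^ (2 * κ i)).toNNReal * A'), fun x hx x' hx' hxx θ hθ hπ => ?_⟩
  -- The size of a cap sees its centre only through the |X_i|.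
  have hsize : capSize κ x' (4 * θ) = capSize κ x (4 * θ) := by
    simp only [capSize, hxx]
  calc measB κ (capB x' (4 * θ)) ≤ A * ENNReal.ofReal (capSize κ x (4 * θ)) := by
        rw [← hsize]
        exact hA x' hx' _ (by positivity)
    _ ≤ A * ENNReal.ofReal
          (((4 : ℝ) ^ d * ∏ i, (4 : ℝ) ^ (2 * κ i)) * capSize κ x θ) := by
        gcongr
        exact capSize_mul_le hκ x (by norm_num) hθ.le
    _ ≤ A * (ENNReal.ofReal ((4 : ℝ) ^ d * ∏ i, (4 : ℝ) ^ (2 * κ i)) *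
          (A' * measB κ (capB x θ))) := by
        rw [ENNReal.ofReal_mul hL0]
        gcongr
        exact hA' x hx θ hθ hπ
    _ = _ := by
        rw [ENNReal.coe_mul, ENNReal.coe_mul, mul_assoc, mul_assoc]
        rfl

theorem measB_capB_doubling {d : ℕ} (hd : 1 ≤ d) {κ : Fin (d + 1) → ℝ} (hκ : ∀ i, 0 ≤ κ i) :
    ∃ C : ℝ≥0, ∀ x ∈ B d, ∀ θ : ℝ, 0 < θ →
      measB κ (capB x (2 * θ)) ≤ C * measB κ (capB x θ) := by
  obtain ⟨C, hC⟩ := measB_capB_four_mul_le hd hκ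
  refine ⟨C, fun x hx θ hθ => ?_⟩
  have hmin : 0 < min θ Real.pi := lt_min hθ Real.pi_pos
  -- The lower cap estimate requires radius at most π. Since d_B ≤ π, truncating θ at π does no
  -- harm.
  calc measB κ (capB x (2 * θ)) ≤ measB κ (capB x (4 * min θ Real.pi)) := by
        refine measure_mono fun y hy => ⟨hy.1, ?_⟩
        have h1 : distB x y ≤ 2 * θ := hy.2
        have h2 : distB x y ≤ Real.pi := Real.arccos_le_pi _
        rcases min_choice θ Real.pi with h | h <;> rw [h] <;> linarith [Real.pi_pos]
    _ ≤ C * measB κ (capB x (min θ Real.pi)) :=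
        hC x hx x hx (fun _ => rfl) _ hmin (min_le_right _ _)
    _ ≤ C * measB κ (capB x θ) := by
        gcongr
        exact fun y hy => ⟨hy.1, hy.2.trans (min_le_left _ _)⟩

/-- The quotient in `hlM` can be multiplied out because the measure of the cap is neither 0 nor ∞.
-/
theorem lintegral_capB_le_hlM_mul {d : ℕ} (hd : 1 ≤ d) {κ : Fin (d + 1) → ℝ} (hκ : ∀ i, 0 ≤ κ i)
    (f : EuclideanSpace ℝ (Fin d) → ℝ) {x : EuclideanSpace ℝ (Fin d)} (hx : x ∈ B d) {θ : ℝ}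
    (hθ : θ ∈ Ioc 0 Real.pi) :
    ∫⁻ y in capB x θ, ENNReal.ofReal |f y| ∂(measB κ) ≤ hlM κ f x * measB κ (capB x θ) := by
  rw [← ENNReal.div_le_iff (measB_capB_pos hd hκ hx hθ.1).ne' (measB_capB_lt_top hd hκ hx hθ.1).ne]
  exact le_iSup₂ (f := fun θ (_ : θ ∈ Ioc 0 Real.pi) =>
    (∫⁻ y in capB x θ, ENNReal.ofReal |f y| ∂(measB κ)) / measB κ (capB x θ)) θ hθ

theorem measB_ae_mem_B {d : ℕ} (κ : Fin (d + 1) → ℝ) : ∀ᵐ y ∂(measB κ), y ∈ B d :=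
  (withDensity_absolutelyContinuous _ _).ae_le (ae_restrict_mem measurableSet_closedBall)

theorem lintegral_mul_kernelB_le {d : ℕ} {κ : Fin (d + 1) → ℝ} (hκ : ∀ i, 0 ≤ κ i) :
    ∃ C : ℝ≥0, ∀ f : EuclideanSpace ℝ (Fin d) → ℝ, ∀ x ∈ B d, ∀ θ ∈ Ioc 0 Real.pi,
      ∫⁻ y, ENNReal.ofReal |f y| * ENNReal.ofReal (kernelB κ x θ y) ∂(measB κ) ≤
        C * ENNReal.ofReal (kernelSize κ x θ) *
          ∑ ε, ∫⁻ y in capB (signAct x ε) θ, ENNReal.ofReal |f y| ∂(measB κ) := by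
  obtain ⟨C, hC⟩ := ofReal_kernelB_le hκ
  refine ⟨C, fun f x hx θ hθ => ?_⟩
  calc ∫⁻ y, ENNReal.ofReal |f y| * ENNReal.ofReal (kernelB κ x θ y) ∂(measB κ)
      ≤ ∫⁻ y, (⋃ ε, capB (signAct x ε) θ).indicator (fun y =>
          C * ENNReal.ofReal (kernelSize κ x θ) * ENNReal.ofReal |f y|) y ∂(measB κ) := by
        refine lintegral_mono_ae ?_
        filter_upwards [measB_ae_mem_B κ] with y hy
        refine (mul_le_mul_right (hC x hx y hy θ hθ.1 hθ.2) _).trans (le_of_eq ?_)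
        by_cases h : y ∈ ⋃ ε, capB (signAct x ε) θ
        · rw [indicator_of_mem h, indicator_of_mem h, mul_comm]
        · rw [indicator_of_notMem h, indicator_of_notMem h, mul_zero]
    _ = C * ENNReal.ofReal (kernelSize κ x θ) *
          ∫⁻ y in ⋃ ε, capB (signAct x ε) θ, ENNReal.ofReal |f y| ∂(measB κ) := by
        rw [lintegral_indicator (MeasurableSet.iUnion fun ε => measurableSet_capB _ _),
          lintegral_const_mul' _ _ (ENNReal.mul_ne_top ENNReal.coe_ne_top ENNReal.ofReal_ne_top)]
    _ ≤ _ := by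
        gcongr
        refine (lintegral_iUnion_le _ _).trans (le_of_eq (tsum_fintype _))

theorem le_lintegral_kernelB {d : ℕ} {κ : Fin (d + 1) → ℝ} (hκ : ∀ i, 0 ≤ κ i) :
    ∃ C : ℝ≥0, ∀ x ∈ B d, ∀ θ ∈ Ioc 0 Real.pi,
      ENNReal.ofReal (kernelSize κ x θ) * measB κ (capB x (θ / 4)) ≤
        C * ∫⁻ y, ENNReal.ofReal (kernelB κ x θ y) ∂(measB κ) := by
  obtain ⟨C, hC⟩ := le_ofReal_kernelB hκ
  refine ⟨C, fun x hx θ hθ => ?_⟩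
  calc ENNReal.ofReal (kernelSize κ x θ) * measB κ (capB x (θ / 4))
      = ∫⁻ _y in capB x (θ / 4), ENNReal.ofReal (kernelSize κ x θ) ∂(measB κ) :=
        (setLIntegral_const _ _).symm
    _ ≤ ∫⁻ y in capB x (θ / 4), C * ENNReal.ofReal (kernelB κ x θ y) ∂(measB κ) :=
        setLIntegral_mono' (measurableSet_capB _ _) fun y hy => hC x hx θ hθ.1 hθ.2 y hy
    _ ≤ ∫⁻ y, C * ENNReal.ofReal (kernelB κ x θ y) ∂(measB κ) := setLIntegral_le_lintegral _ _
    _ = _ := lintegral_const_mul' _ _ ENNReal.coe_ne_top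

theorem calM_le_sum_hlM {d : ℕ} (hd : 1 ≤ d) {κ : Fin (d + 1) → ℝ} (hκ : ∀ i, 0 ≤ κ i) :
    ∃ c : ℝ≥0, ∀ f : EuclideanSpace ℝ (Fin d) → ℝ, ∀ x ∈ B d,
      calM κ f x ≤ c * ∑ ε : Fin d → ℤˣ, hlM κ f (signAct x ε) := by
  obtain ⟨C₁, h₁⟩ := lintegral_mul_kernelB_le hκ
  obtain ⟨C₂, h₂⟩ := le_lintegral_kernelB hκ
  obtain ⟨C₃, h₃⟩ := measB_capB_four_mul_le hd hκ
  refine ⟨C₁ * C₃ * C₂, fun f x hx => iSup₂_le fun θ hθ => ENNReal.div_le_of_le_mul ?_⟩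
  have hθ4 : θ / 4 ≤ Real.pi := by linarith [hθ.1, hθ.2]
  set K := ENNReal.ofReal (kernelSize κ x θ)
  calc ∫⁻ y, ENNReal.ofReal |f y| * ENNReal.ofReal (kernelB κ x θ y) ∂(measB κ)
      ≤ C₁ * K * ∑ ε, ∫⁻ y in capB (signAct x ε) θ, ENNReal.ofReal |f y| ∂(measB κ) :=
        h₁ f x hx θ hθ
    _ ≤ C₁ * K * ∑ ε : Fin d → ℤˣ,
          hlM κ f (signAct x ε) * (C₃ * measB κ (capB x (θ / 4))) := by
        gcongr with ε
        refine (lintegral_capB_le_hlM_mul hd hκ f (signAct_mem_B hx ε) hθ).trans ?_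
        gcongr
        -- The radius θ is 4 · (θ/4): one estimate both moves the centre from xε to x and shrinks
        -- the cap to the region where the kernel is bounded below.
        have h := h₃ x hx (signAct x ε) (signAct_mem_B hx ε) (abs_lift_signAct x ε) (θ / 4)
          (by linarith [hθ.1]) hθ4
        rwa [mul_div_cancel₀ θ (by norm_num : (4 : ℝ) ≠ 0)] at h
    -- Regrouping puts the kernel size K next to the measure of the quarter cap, a product bounded
    -- by the denominator of `calM`.
    _ = C₁ * C₃ * (∑ ε : Fin d → ℤˣ, hlM κ f (signAct x ε)) *
          (K * measB κ (capB x (θ / 4))) := by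
        rw [← Finset.sum_mul]
        ring
    _ ≤ C₁ * C₃ * (∑ ε : Fin d → ℤˣ, hlM κ f (signAct x ε)) *
          (C₂ * ∫⁻ y, ENNReal.ofReal (kernelB κ x θ y) ∂(measB κ)) :=
        mul_le_mul_right (h₂ x hx θ hθ) _
    _ = _ := by
        rw [ENNReal.coe_mul, ENNReal.coe_mul]
        ring

end BallMax

theorem mainTheorem10 (d : ℕ) (hd : 1 ≤ d) (κ : Fin (d + 1) → ℝ) (hκ : ∀ i, 0 ≤ κ i) :
    (∃ c : ℝ≥0, ∀ f : EuclideanSpace ℝ (Fin d) → ℝ, Integrable f (BallMax.measB κ) →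
      ∀ x ∈ BallMax.B d,
        BallMax.calM κ f x ≤
          (c : ℝ≥0∞) * ∑ ε : Fin d → ℤˣ, BallMax.hlM κ f (BallMax.signAct x ε)) ∧
    (∃ C : ℝ≥0, ∀ x ∈ BallMax.B d, ∀ θ : ℝ, 0 < θ →
      0 < BallMax.measB κ (BallMax.capB x θ) ∧
      BallMax.measB κ (BallMax.capB x (2 * θ)) < ∞ ∧
      BallMax.measB κ (BallMax.capB x (2 * θ)) ≤
        (C : ℝ≥0∞) * BallMax.measB κ (BallMax.capB x θ)) := by
  obtain ⟨c, hc⟩ := BallMax.calM_le_sum_hlM hd hκ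
  obtain ⟨C, hC⟩ := BallMax.measB_capB_doubling hd hκ
  exact ⟨⟨c, fun f _ x hx => hc f x hx⟩, ⟨C, fun x hx θ hθ => ⟨BallMax.measB_capB_pos hd hκ hx hθ,
    BallMax.measB_capB_lt_top hd hκ hx (by positivity), hC x hx θ hθ⟩⟩⟩
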